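/- **Setting.** Let $m\ge n$ be integers and let $p>n$ be real. Let $\mathcal U\subset\mathbb R^n$ be a non-empty connected open set and $V=(V^i)\in C(\mathcal U,\mathbb R^n)$. For $V\in C^1(\mathcal U,\mathbb R^n)$ let $\varphi^t$ be the local flow on $\mathcal U$ of $\dot x=V(x)$, so that $\varphi^t(\xi)$ is the solution starting at $\xi$, for $t$ in its maximal interval $\mathcal I_\xi$ of existence in $\mathcal U$. A set $B\subset\mathcal U$ is invariant if, for all $\xi\in B$, $\mathcal I_\xi=\mathbb R$, and $\varphi^t(B)=B$ for all $t\in\mathbb R$. It is positively (resp. negatively) invariant if, for all $\xi\in B$, $\mathcal I_\xi\supset[0,\infty)$ (resp. $\mathcal I_\xi\supset(-\infty,0]$), and $\varphi^t(B)\subset B$ for all $t\ge0$ (resp. $t\le 0$). The local flow is a flow on $\mathcal U$ if $\mathcal U$ is invariant. *Null families.* Let $\tilde{\mathcal A}$ be the set of matrix functions $A=(a^{ij})\in W^{1,p}_{loc}(\mathcal U,GL(n,\mathbb R))$ of the form $A=\frac12GG^\top$, where $G=(g^{ij})$ is an $n\times m$ matrix function of rank $n$ everywhere on $\mathcal U$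 with $g^{ij}\in W^{1,2p}_{loc}(\mathcal U)$ (continuous representatives are used). A null family $\mathcal A=\{A_\alpha\}\subset\tilde{\mathcal A}$ is a net indexed by a directed set that converges to the zero matrix in $W^{1,p}$ on every compact subset of $\mathcal U$. *Limit measures.* A stationary measure corresponding to $A=(a^{ij})\in\tilde{\mathcal A}$ is a Borel probability measure $\mu$ on $\mathcal U$ with $$\int_{\mathcal U}\Big(\sum_{i,j}a^{ij}\partial^2_{ij}f+\sum_iV^i\partial_if\Big)\,d\mu=0\qquad\text{for all } f\in C_0^\infty(\mathcal U).$$ An $\mathcal A$-limit measure is a Borel probability measure $\mu$ on $\mathcal U$ for which there are members $A_1,A_2,\dots$ of $\mathcal A$ with $A_l\to0$ (in $W^{1,p}$ on every compact subset of $\mathcal U$) and stationary measures $\mu_l$ corresponding to $A_l$ with $\int f\,d\mu_l\to\int f\,d\mu$ for all bounded continuous $f$ on $\mathcal U$. *Lyapunov functions.* An entire weak Lyapunov (resp. anti-Lyapunov) function of $\dot x=V(x)$ in $\mathcal U$ is a non-negative function $U_0\in C^1(\mathcal U)$ such that, with $\rho_M=\sup_{\mathcal U}U_0\in(0,\infty]$,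 one has $U_0<\rho_M$ on $\mathcal U$, $U_0(x)\to\rho_M$ as $x$ leaves every compact subset of $\mathcal U$, and $V\cdot\nabla U_0\le0$ (resp. $\ge0$) on all of $\mathcal U$. *Strong attractors and repellers* (for $V\in C^1$). A strong local attractor (resp. repeller) of $\varphi^t$ is a compact invariant set $\mathcal E_0\subset\mathcal U$ that has a connected, positively (resp. negatively) invariant neighborhood $\mathcal W\subset\mathcal U$ whose boundary in $\mathcal U$ is an oriented $C^2$ hypersurface with outward unit normal $\nu$, such that $V\cdot\nu<0$ (resp. $>0$) on this boundary, and such that the Hausdorff semi-distance $\sup_{y\in\varphi^t(\mathcal W)}\operatorname{dist}(y,\mathcal E_0)$ tends to $0$ as $t\to+\infty$ (resp. $t\to-\infty$). **Theorem A.** Let $\mathcal A=\{A_\alpha\}\subset\tilde{\mathcal A}$ be a null family. Then the following holds. (a) (Invariance of limit measures) If $V\in C^1(\mathcal U,\mathbb R^n)$ and $\varphi^t$ is a flow on $\mathcal U$, then every $\mathcal A$-limit measure $\mu$ is an invariant measure of $\varphi^t$, that is, $\mu(\varphi^{-t}(B))=\mu(B)$ for all Borel sets $B\subset\mathcal U$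 and all $t\in\mathbb R$. (b) (Stochastic LaSalle invariance principle) If $\dot x=V(x)$ admits an entire weak Lyapunov (resp. anti-Lyapunov) function $U_0$ in $\mathcal U$, then every $\mathcal A$-limit measure $\mu$ with compact support in $\mathcal U$ is concentrated on $S_0=\{x\in\mathcal U: V(x)\cdot\nabla U_0(x)=0\}$, that is, $\mu(S_0)=1$. (c) (Local concentration of limit measures) If $V\in C^1(\mathcal U,\mathbb R^n)$ and $\mathcal E_0$ is a strong local attractor or a strong local repeller of $\varphi^t$, then there is a neighborhood $\mathcal W_0\subset\mathcal U$ of $\mathcal E_0$ such that $\mu(\mathcal W_0\setminus\mathcal E_0)=0$ for every $\mathcal A$-limit measure $\mu$. -/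

import Mathlib

open MeasureTheory Set Filter Topology
open scoped ENNReal ContDiff Gradient

namespace StationaryLimit

/-- The Euclidean space `ℝⁿ`. -/
abbrev Eucl (n : ℕ) : Type := EuclideanSpace ℝ (Fin n)

/-! ### Test functions, classical and weak partial derivatives -/

/-- `f` is a `C^∞` function with compact support contained in `U`. -/
def IsTestFunction {n : ℕ} (U : Set (Eucl n)) (f : Eucl n → ℝ) : Prop :=
  ContDiff ℝ ∞ f ∧ HasCompactSupport f ∧ tsupport f ⊆ U

/-- The classical partial derivative `∂ᵢ f`. -/
noncomputable def partialDeriv {n : ℕ} (i : Fin n) (f : Eucl n → ℝ) (x : Eucl n) : ℝ :=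
  fderiv ℝ f x (EuclideanSpace.single i 1)

/-- `g` is a weak `i`-th partial derivative of `f` on `U`. -/
def HasWeakPartial {n : ℕ} (U : Set (Eucl n)) (i : Fin n) (f g : Eucl n → ℝ) : Prop :=
  LocallyIntegrableOn f U ∧ LocallyIntegrableOn g U ∧
    ∀ φ : Eucl n → ℝ, IsTestFunction U φ →
      ∫ x in U, f x * partialDeriv i φ x = -∫ x in U, g x * φ x

open Classical in
/-- The weak `i`-th partial derivative of `f` on `U` (unique up to null sets; `0` if there is
none). -/
noncomputable def weakPartial {n : ℕ} (U : Set (Eucl n)) (i : Fin n) (f : Eucl n → ℝ) :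
    Eucl n → ℝ :=
  if h : ∃ g, HasWeakPartial U i f g then h.choose else 0

/-- `f ∈ L^q_loc(U)`. -/
def MemLqLoc {n : ℕ} (q : ℝ) (U : Set (Eucl n)) (f : Eucl n → ℝ) : Prop :=
  ∀ K : Set (Eucl n), K ⊆ U → IsCompact K → MemLp f (ENNReal.ofReal q) (volume.restrict K)

/-- `f ∈ W^{1,q}_loc(U)`. -/
def MemW1Loc {n : ℕ} (q : ℝ) (U : Set (Eucl n)) (f : Eucl n → ℝ) : Prop :=
  MemLqLoc q U f ∧ ∀ i : Fin n, ∃ g, HasWeakPartial U i f g ∧ MemLqLoc q U g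

/-- The `W^{1,q}`-norm of `f` on a subset `K` of `U`. -/
noncomputable def w1Norm {n : ℕ} (q : ℝ) (U : Set (Eucl n)) (K : Set (Eucl n))
    (f : Eucl n → ℝ) : ℝ≥0∞ :=
  eLpNorm f (ENNReal.ofReal q) (volume.restrict K) +
    ∑ i : Fin n, eLpNorm (weakPartial U i f) (ENNReal.ofReal q) (volume.restrict K)

/-! ### Diffusion matrices and null families -/

/-- The noise coefficient matrices: `n × m` matrix functions of rank `n` everywhere on `U` with
entries in `W^{1,2p}_loc(U)`. As `2p > n`, an element of `W^{1,2p}_loc(U)` has a unique continuous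
representative, and this is the one that is used. -/
structure IsNoiseMatrix {n m : ℕ} (p : ℝ) (U : Set (Eucl n))
    (G : Eucl n → Matrix (Fin n) (Fin m) ℝ) : Prop where
  continuousOn : ContinuousOn G U
  sobolev : ∀ i j, MemW1Loc (2 * p) U (fun x => G x i j)
  rank_eq : ∀ x ∈ U, (G x).rank = n

/-- The diffusion matrices `A = G Gᵀ / 2`, with `m` the number of columns of `G`. -/
structure IsDiffusionMatrix {n : ℕ} (m : ℕ) (p : ℝ) (U : Set (Eucl n))
    (A : Eucl n → Matrix (Fin n) (Fin n) ℝ) : Prop where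
  sobolev : ∀ i j, MemW1Loc p U (fun x => A x i j)
  isUnit_det : ∀ x ∈ U, IsUnit (A x).det
  exists_noise : ∃ G : Eucl n → Matrix (Fin n) (Fin m) ℝ, IsNoiseMatrix p U G ∧
    ∀ x ∈ U, A x = (1 / 2 : ℝ) • (G x * (G x).transpose)

/-- `A_α → 0` along the filter `l`, in `W^{1,p}` on every compact subset of `U`. -/
def TendstoZeroW1 {n : ℕ} {ι : Type*} (p : ℝ) (U : Set (Eucl n))
    (A : ι → Eucl n → Matrix (Fin n) (Fin n) ℝ) (l : Filter ι) : Prop :=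
  ∀ K : Set (Eucl n), K ⊆ U → IsCompact K → ∀ i j,
    Tendsto (fun α => w1Norm p U K (fun x => A α x i j)) l (𝓝 0)

/-- A null family: a net of diffusion matrices that converges to the zero matrix. -/
structure IsNullFamily {n : ℕ} {ι : Type*} [Preorder ι] (m : ℕ) (p : ℝ) (U : Set (Eucl n))
    (A : ι → Eucl n → Matrix (Fin n) (Fin n) ℝ) : Prop where
  isDiffusion : ∀ α, IsDiffusionMatrix m p U (A α)
  tendsto_zero : TendstoZeroW1 p U A atTop

/-! ### Stationary measures and their limits -/

/-- The adjoint Fokker-Planck operator `𝓛_A f = aⁱʲ ∂²ᵢⱼ f + Vⁱ ∂ᵢ f`. -/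
noncomputable def adjointFP {n : ℕ} (V : Eucl n → Eucl n)
    (A : Eucl n → Matrix (Fin n) (Fin n) ℝ) (f : Eucl n → ℝ) (x : Eucl n) : ℝ :=
  (∑ i : Fin n, ∑ j : Fin n, A x i j * partialDeriv i (partialDeriv j f) x) +
    ∑ i : Fin n, V x i * partialDeriv i f x

/-- `μ`, a Borel probability measure on `U`, is a stationary measure corresponding to `𝓛_A`. -/
def IsStationaryMeasure {n : ℕ} {U : Set (Eucl n)} (V : Eucl n → Eucl n)
    (A : Eucl n → Matrix (Fin n) (Fin n) ℝ) (μ : ProbabilityMeasure U) : Prop :=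
  ∀ f : Eucl n → ℝ, IsTestFunction U f → ∫ x : U, adjointFP V A f x ∂(μ : Measure U) = 0

/-- `μ` is an `𝒜`-limit measure: the limit, in the topology of weak convergence of Borel
probability measures on `U`, of a sequence of stationary measures that correspond to members of
the family converging to `0`. -/
def IsLimitMeasure {n : ℕ} {ι : Type*} {U : Set (Eucl n)} (p : ℝ) (V : Eucl n → Eucl n)
    (A : ι → Eucl n → Matrix (Fin n) (Fin n) ℝ) (μ : ProbabilityMeasure U) : Prop :=
  ∃ (α : ℕ → ι) (ν : ℕ → ProbabilityMeasure U),
    TendstoZeroW1 p U (fun k => A (α k)) atTop ∧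
    (∀ k, IsStationaryMeasure V (A (α k)) (ν k)) ∧
    Tendsto ν atTop (𝓝 μ)

/-! ### The local flow of `ẋ = V(x)` on `U` -/

/-- `γ` is a solution of `ẋ = V(x)` in `U`, starting at `ξ`, over the compact time interval with
end points `0` and `t`. -/
def IsSolutionUpTo {n : ℕ} (V : Eucl n → Eucl n) (U : Set (Eucl n)) (ξ : Eucl n) (t : ℝ)
    (γ : ℝ → Eucl n) : Prop :=
  γ 0 = ξ ∧ (∀ s ∈ uIcc 0 t, γ s ∈ U) ∧ IsIntegralCurveOn γ (fun _ => V) (uIcc 0 t)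

/-- The maximal interval of existence in `U` of the solution that starts at `ξ`. -/
def existenceInterval {n : ℕ} (V : Eucl n → Eucl n) (U : Set (Eucl n)) (ξ : Eucl n) : Set ℝ :=
  {t | ∃ γ, IsSolutionUpTo V U ξ t γ}

open Classical in
/-- The local flow: `localFlow V U t ξ = φᵗ(ξ)` is the value at time `t` of the solution that
starts at `ξ`. (It is used only for `t` in the existence interval of `ξ` and for `C¹` fields `V`,
whose solutions are unique.) -/
noncomputable def localFlow {n : ℕ} (V : Eucl n → Eucl n) (U : Set (Eucl n)) (t : ℝ)
    (ξ : Eucl n) : Eucl n :=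
  if h : ∃ γ, IsSolutionUpTo V U ξ t γ then h.choose t else ξ

/-- `B ⊆ U` is an invariant set of the local flow. -/
def IsInvariantSet {n : ℕ} (V : Eucl n → Eucl n) (U B : Set (Eucl n)) : Prop :=
  B ⊆ U ∧ (∀ ξ ∈ B, existenceInterval V U ξ = univ) ∧ ∀ t : ℝ, localFlow V U t '' B = B

/-- `B ⊆ U` is a positively invariant set of the local flow. -/
def IsPositivelyInvariantSet {n : ℕ} (V : Eucl n → Eucl n) (U B : Set (Eucl n)) : Prop :=
  B ⊆ U ∧ (∀ ξ ∈ B, Ici 0 ⊆ existenceInterval V U ξ) ∧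
    ∀ t : ℝ, 0 ≤ t → localFlow V U t '' B ⊆ B

/-- `B ⊆ U` is a negatively invariant set of the local flow. -/
def IsNegativelyInvariantSet {n : ℕ} (V : Eucl n → Eucl n) (U B : Set (Eucl n)) : Prop :=
  B ⊆ U ∧ (∀ ξ ∈ B, Iic 0 ⊆ existenceInterval V U ξ) ∧
    ∀ t : ℝ, t ≤ 0 → localFlow V U t '' B ⊆ B

/-- The local flow is a flow on `U`. -/
def IsFlow {n : ℕ} (V : Eucl n → Eucl n) (U : Set (Eucl n)) : Prop :=
  IsInvariantSet V U U

/-- `μ` is an invariant measure on `U` of the flow: `μ(φ⁻ᵗ(B)) = μ(B)` for all Borel `B ⊆ U` and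
all real `t`. -/
def IsInvariantMeasure {n : ℕ} {U : Set (Eucl n)} (V : Eucl n → Eucl n)
    (μ : ProbabilityMeasure U) : Prop :=
  ∀ B : Set U, MeasurableSet B → ∀ t : ℝ,
    (μ : Measure U) {x : U | localFlow V U t x ∈ Subtype.val '' B} = (μ : Measure U) B

/-! ### Compact functions and entire weak Lyapunov functions -/

/-- The essential upper bound `sup_U F`, possibly `+∞`. -/
noncomputable def essUpperBound {n : ℕ} (U : Set (Eucl n)) (F : Eucl n → ℝ) : EReal :=
  ⨆ x ∈ U, (F x : EReal)

/-- `F` is a compact function on the open set `U`: continuous, non-negative, everywhere below its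
supremum and converging to it at the boundary of `U` (points at infinity included), that is,
as `x` leaves every compact subset of `U`. -/
structure IsCompactFunction {n : ℕ} (U : Set (Eucl n)) (F : Eucl n → ℝ) : Prop where
  continuousOn : ContinuousOn F U
  nonneg : ∀ x ∈ U, 0 ≤ F x
  lt_bound : ∀ x ∈ U, (F x : EReal) < essUpperBound U F
  tendsto_bound :
    Tendsto (fun x : U => (F x : EReal)) (cocompact U) (𝓝 (essUpperBound U F))

/-- `F` is an entire weak Lyapunov function of `ẋ = V(x)` in `U`. -/
def IsEntireWeakLyapunov {n : ℕ} (V : Eucl n → Eucl n) (U : Set (Eucl n))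
    (F : Eucl n → ℝ) : Prop :=
  ContDiffOn ℝ 1 F U ∧ IsCompactFunction U F ∧ ∀ x ∈ U, inner ℝ (V x) (∇ F x) ≤ 0

/-- `F` is an entire weak anti-Lyapunov function of `ẋ = V(x)` in `U`. -/
def IsEntireWeakAntiLyapunov {n : ℕ} (V : Eucl n → Eucl n) (U : Set (Eucl n))
    (F : Eucl n → ℝ) : Prop :=
  ContDiffOn ℝ 1 F U ∧ IsCompactFunction U F ∧ ∀ x ∈ U, 0 ≤ inner ℝ (V x) (∇ F x)

/-! ### Strong local attractors and repellers -/

/-- Near its boundary point `x` the set `W` is a `C²` domain (its interior is the negative side,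
and its boundary the zero set, of a regular `C²` function `g`), with outward unit normal `ν` at
`x`. -/
def IsOutwardUnitNormal {n : ℕ} (W : Set (Eucl n)) (x ν : Eucl n) : Prop :=
  x ∈ frontier W ∧ ∃ (N : Set (Eucl n)) (g : Eucl n → ℝ),
    IsOpen N ∧ x ∈ N ∧ ContDiffOn ℝ 2 g N ∧ (∀ y ∈ N, ∇ g y ≠ 0) ∧
    (∀ y ∈ N, y ∈ interior W ↔ g y < 0) ∧ (∀ y ∈ N, y ∈ frontier W ↔ g y = 0) ∧
    ν = ‖∇ g x‖⁻¹ • ∇ g x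

/-- The boundary of `W` in `U` is an oriented `C²` hypersurface. -/
def HasOrientedC2Boundary {n : ℕ} (U W : Set (Eucl n)) : Prop :=
  ∀ x ∈ frontier W ∩ U, ∃ ν, IsOutwardUnitNormal W x ν

/-- `J` attracts `W`: the Hausdorff semi-distance from `φᵗ(W)` to `J` tends to `0` as
`t → +∞`. -/
def Attracts {n : ℕ} (V : Eucl n → Eucl n) (U J W : Set (Eucl n)) : Prop :=
  ∀ ε : ℝ, 0 < ε → ∀ᶠ t : ℝ in atTop, localFlow V U t '' W ⊆ Metric.thickening ε J

/-- `R` repels `W`: the Hausdorff semi-distance from `φᵗ(W)` to `R` tends to `0` as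
`t → -∞`. -/
def Repels {n : ℕ} (V : Eucl n → Eucl n) (U R W : Set (Eucl n)) : Prop :=
  ∀ ε : ℝ, 0 < ε → ∀ᶠ t : ℝ in atBot, localFlow V U t '' W ⊆ Metric.thickening ε R

/-- `J` is a strong local attractor; `W` is an isolating neighborhood. -/
def IsStrongLocalAttractor {n : ℕ} (V : Eucl n → Eucl n) (U J : Set (Eucl n)) : Prop :=
  IsCompact J ∧ IsInvariantSet V U J ∧ ∃ W : Set (Eucl n),
    W ∈ 𝓝ˢ J ∧ IsConnected W ∧ IsPositivelyInvariantSet V U W ∧ HasOrientedC2Boundary U W ∧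
    Attracts V U J W ∧
    ∀ x ∈ frontier W ∩ U, ∀ ν, IsOutwardUnitNormal W x ν → inner ℝ (V x) ν < 0

/-- `R` is a strong local repeller; `W` is an isolating neighborhood. -/
def IsStrongLocalRepeller {n : ℕ} (V : Eucl n → Eucl n) (U R : Set (Eucl n)) : Prop :=
  IsCompact R ∧ IsInvariantSet V U R ∧ ∃ W : Set (Eucl n),
    W ∈ 𝓝ˢ R ∧ IsConnected W ∧ IsNegativelyInvariantSet V U W ∧ HasOrientedC2Boundary U W ∧
    Repels V U R W ∧
    ∀ x ∈ frontier W ∩ U, ∀ ν, IsOutwardUnitNormal W x ν → 0 < inner ℝ (V x) ν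

end StationaryLimit

open StationaryLimit

/-! As the noise vanishes, the stationary Fokker-Planck equation degenerates to the stationary
Liouville equation `∫ V·∇f dμ = 0` for test functions `f`, and the three assertions are consequences
of this equation. In the limit the drift term passes by weak convergence. The diffusion term tends
to `0` because `A_l → 0` uniformly on the support of `f`: since `p > n`, Morrey's inequality
(`exists_abs_le_of_hasWeakPartial`) turns `W^{1,p}` convergence into local uniform convergence. The
outcome is `IsLimitMeasure.isLiouvilleStationary`.

For a `C¹` field, formally `d/ds ∫ f∘φˢ dμ = ∫ V·∇(f∘φˢ) dμ = 0`. Here `f∘φˢ` is treated as merely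
Lipschitz, while `μ` may be singular; so the equation is extended to Lipschitz functions whose
derivative along `V` has a continuous version (`IsLiouvilleStationary.integral_eq_zero`). Replacing
`V` near a compact set by a globally Lipschitz field and exhausting by orbit segments that stay in
compact sets, one gets `μ(φᵗ(B)) = μ(B)` for σ-compact `B` on which `φᵗ` is defined
(`IsLiouvilleStationary.measure_image_localFlow`).

Assertion (a) follows because closed sets generate the Borel sets. For (b), test with `χ U₀`, where
`χ = 1` near the support of `μ`: the integral of `V·∇U₀`, which has one sign, vanishes. For (c), the
orbit `D` of a compact neighbourhood of the attractor is mapped into itself without loss of measure,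
while its images shrink to the attractor; a repeller is the same in reversed time. -/

namespace StationaryLimit

/-! ### Global flows of bounded Lipschitz fields -/

section

section GlobalFlow

variable {E : Type*} [NormedAddCommGroup E] [NormedSpace ℝ E]

/-- `Φ` is a global flow of the vector field `W`. -/
structure IsGlobalFlow (W : E → E) (Φ : ℝ → E → E) : Prop where
  map_zero : ∀ x, Φ 0 x = x
  hasDerivAt : ∀ x t, HasDerivAt (fun s => Φ s x) (W (Φ t x)) t

theorem eqOn_uIcc_of_isIntegralCurveOn {W : E → E} {K : NNReal} (hW : LipschitzWith K W)
    {γ₁ γ₂ : ℝ → E} {t : ℝ} (h₁ : IsIntegralCurveOn γ₁ (fun _ => W) (uIcc 0 t))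
    (h₂ : IsIntegralCurveOn γ₂ (fun _ => W) (uIcc 0 t)) (h : γ₁ 0 = γ₂ 0) :
    EqOn γ₁ γ₂ (uIcc 0 t) := by
  rcases le_total 0 t with ht | ht
  · rw [uIcc_of_le ht] at *
    exact ODE_solution_unique (v := fun _ => W) (fun _ => hW) h₁.continuousOn
      (fun s hs => (h₁ s (Ico_subset_Icc_self hs)).mono_of_mem_nhdsWithin
        (Icc_mem_nhdsGE_of_mem hs)) h₂.continuousOn
      (fun s hs => (h₂ s (Ico_subset_Icc_self hs)).mono_of_mem_nhdsWithin
        (Icc_mem_nhdsGE_of_mem hs)) h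
  · rw [uIcc_of_ge ht] at *
    exact ODE_solution_unique_of_mem_Icc_left (v := fun _ => W) (s := fun _ => univ)
      (fun _ _ => hW.lipschitzOnWith) h₁.continuousOn
      (fun s hs => (h₁ s (Ioc_subset_Icc_self hs)).mono_of_mem_nhdsWithin
        (Icc_mem_nhdsLE_of_mem hs)) (fun _ _ => mem_univ _) h₂.continuousOn
      (fun s hs => (h₂ s (Ioc_subset_Icc_self hs)).mono_of_mem_nhdsWithin
        (Icc_mem_nhdsLE_of_mem hs)) (fun _ _ => mem_univ _) h

theorem exists_isGlobalFlow [CompleteSpace E] {W : E → E} {K L : NNReal} (hW : LipschitzWith K W)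
    (hL : ∀ x, ‖W x‖ ≤ L) : ∃ Φ, IsGlobalFlow W Φ := by
  have hsol : ∀ (x : E) (N : ℕ), ∃ α : ℝ → E, α 0 = x ∧
      IsIntegralCurveOn α (fun _ => W) (Icc (-(N : ℝ)) N) := by
    intro x N
    have h0 : (0 : ℝ) ∈ Icc (-(N : ℝ)) N := by simp
    -- The speed is at most `L`, so over time `N` a solution stays in the ball of radius `L * N`.
    -- The Picard-Lindelöf condition thus holds on arbitrarily long intervals.
    have hPL : IsPicardLindelof (fun _ => W) (⟨0, h0⟩ : Icc (-(N : ℝ)) N) x (L * N) 0 L K :=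
      IsPicardLindelof.of_time_independent (fun y _ => hL y) hW.lipschitzOnWith (by simp)
    exact hPL.exists_eq_forall_mem_Icc_hasDerivWithinAt₀
  choose α hα0 hα using hsol
  have hsub : ∀ {s : ℝ} {N : ℕ}, |s| ≤ N → uIcc 0 s ⊆ Icc (-(N : ℝ)) N := by
    intro s N hs
    have := abs_le.1 hs
    exact uIcc_subset_Icc (by simp) this
  have heq : ∀ x (s : ℝ) (M N : ℕ), |s| ≤ M → |s| ≤ N → α x M s = α x N s := fun x s M N hM hN =>
    eqOn_uIcc_of_isIntegralCurveOn hW ((hα x M).mono (hsub hM)) ((hα x N).mono (hsub hN))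
      ((hα0 x M).trans (hα0 x N).symm) right_mem_uIcc
  refine ⟨fun t x => α x ⌈|t|⌉₊ t, fun x => hα0 x _, fun x t => ?_⟩
  -- The extra `1` puts `t` in the interior of the interval, so that one solution represents the
  -- glued curve on a whole neighbourhood of `t`.
  set N := ⌈|t|⌉₊ + 1 with hN
  have htN : |t| < N := by
    rw [hN]; push_cast
    linarith [Nat.le_ceil |t|]
  have hd : HasDerivAt (α x N) (W (α x N t)) t :=
    (hα x N t (abs_le.1 htN.le)).hasDerivAt (Icc_mem_nhds (abs_lt.1 htN).1 (abs_lt.1 htN).2)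
  have ht : α x ⌈|t|⌉₊ t = α x N t := heq x t _ _ (Nat.le_ceil _) htN.le
  simp only [ht]
  refine hd.congr_of_eventuallyEq ?_
  have : ∀ᶠ s : ℝ in 𝓝 t, |s| < (N : ℝ) := continuous_abs.continuousAt.eventually (gt_mem_nhds htN)
  filter_upwards [this] with s hs
  exact heq x s _ _ (Nat.le_ceil _) hs.le

variable {W : E → E} {Φ : ℝ → E → E} {K : NNReal}

theorem IsGlobalFlow.isIntegralCurveOn (hΦ : IsGlobalFlow W Φ) (x : E) (s : Set ℝ) :
    IsIntegralCurveOn (fun s => Φ s x) (fun _ => W) s :=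
  fun t _ => (hΦ.hasDerivAt x t).hasDerivWithinAt

theorem IsGlobalFlow.eq_of_isIntegralCurveOn (hΦ : IsGlobalFlow W Φ) (hW : LipschitzWith K W)
    {γ : ℝ → E} {t s : ℝ} (hγ : IsIntegralCurveOn γ (fun _ => W) (uIcc 0 t)) (hs : s ∈ uIcc 0 t) :
    γ s = Φ s (γ 0) :=
  eqOn_uIcc_of_isIntegralCurveOn hW hγ (hΦ.isIntegralCurveOn (γ 0) _) (hΦ.map_zero _).symm hs

theorem IsGlobalFlow.map_add (hΦ : IsGlobalFlow W Φ) (hW : LipschitzWith K W) (s t : ℝ) (x : E) :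
    Φ (s + t) x = Φ s (Φ t x) := by
  have h : IsIntegralCurveOn (fun u => Φ (u + t) x) (fun _ => W) (uIcc 0 s) := fun u _ =>
    ((hΦ.hasDerivAt x (u + t)).comp_add_const u t).hasDerivWithinAt
  simpa using hΦ.eq_of_isIntegralCurveOn hW h right_mem_uIcc

theorem IsGlobalFlow.neg (hΦ : IsGlobalFlow W Φ) : IsGlobalFlow (-W) fun t => Φ (-t) where
  map_zero x := by simpa using hΦ.map_zero x
  hasDerivAt x t := by
    simpa [Function.comp_def] using (hΦ.hasDerivAt x (-t)).scomp t (hasDerivAt_neg t)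

/-- Grönwall's inequality for `t ≥ 0`; negative times are positive times of the reversed flow, whose
field has the same Lipschitz constant. -/
theorem IsGlobalFlow.dist_le (hΦ : IsGlobalFlow W Φ) (hW : LipschitzWith K W) (t : ℝ) (x y : E) :
    dist (Φ t x) (Φ t y) ≤ dist x y * Real.exp (K * |t|) := by
  have key : ∀ {W : E → E} {Φ : ℝ → E → E}, IsGlobalFlow W Φ → LipschitzWith K W →
      ∀ t, 0 ≤ t → dist (Φ t x) (Φ t y) ≤ dist x y * Real.exp (K * t) := by
    intro W Φ hΦ hW t ht
    have h := dist_le_of_trajectories_ODE (v := fun _ => W) (a := 0) (b := t) (fun _ => hW)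
      (hΦ.isIntegralCurveOn x (Icc 0 t)).continuousOn
      (fun s _ => (hΦ.hasDerivAt x s).hasDerivWithinAt)
      (hΦ.isIntegralCurveOn y (Icc 0 t)).continuousOn
      (fun s _ => (hΦ.hasDerivAt y s).hasDerivWithinAt)
      (δ := dist x y) (by simp [hΦ.map_zero]) t ⟨ht, le_rfl⟩
    simpa using h
  rcases le_total 0 t with ht | ht
  · rw [abs_of_nonneg ht]
    exact key hΦ hW t ht
  · rw [abs_of_nonpos ht]
    simpa using key hΦ.neg hW.neg (-t) (by linarith)

theorem IsGlobalFlow.lipschitzWith (hΦ : IsGlobalFlow W Φ) (hW : LipschitzWith K W) (t : ℝ) :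
    LipschitzWith (Real.toNNReal (Real.exp (K * |t|))) (Φ t) :=
  LipschitzWith.of_dist_le_mul fun x y => by
    rw [Real.coe_toNNReal _ (Real.exp_pos _).le, mul_comm]
    exact hΦ.dist_le hW t x y

theorem IsGlobalFlow.neg_apply_apply (hΦ : IsGlobalFlow W Φ) (hW : LipschitzWith K W) (t : ℝ)
    (x : E) : Φ (-t) (Φ t x) = x := by
  rw [← hΦ.map_add hW, neg_add_cancel, hΦ.map_zero]

theorem IsGlobalFlow.apply_neg_apply (hΦ : IsGlobalFlow W Φ) (hW : LipschitzWith K W) (t : ℝ)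
    (x : E) : Φ t (Φ (-t) x) = x := by
  rw [← hΦ.map_add hW, add_neg_cancel, hΦ.map_zero]

end GlobalFlow

/-! ### Cutoffs and localization of vector fields -/

section Cutoff

variable {E : Type*} [NormedAddCommGroup E] [NormedSpace ℝ E]

/-- A smooth cutoff function that is `1` near a compact set and supported in a given open set. -/
theorem exists_contDiff_cutoff [FiniteDimensional ℝ E] {K U : Set E} (hK : IsCompact K) (hU : IsOpen U) (hKU : K ⊆ U) :
    ∃ χ : E → ℝ, ContDiff ℝ ∞ χ ∧ HasCompactSupport χ ∧ tsupport χ ⊆ U ∧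
      (∀ᶠ x in 𝓝ˢ K, χ x = 1) ∧ ∀ x, χ x ∈ Icc (0 : ℝ) 1 := by
  obtain ⟨L, hL, hKL, hLU⟩ := exists_compact_between hK hU hKU
  obtain ⟨χ, h1, h0, h01⟩ := exists_contMDiffMap_one_nhds_of_subset_interior
    (modelWithCornersSelf ℝ E) (n := (⊤ : ℕ∞)) hK.isClosed hKL
  have hsupp : tsupport χ ⊆ L := closure_minimal
    (fun x hx => by_contra fun h => hx (h0 x h)) hL.isClosed
  exact ⟨χ, χ.contMDiff.contDiff, hL.of_isClosed_subset (isClosed_tsupport _) hsupp,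
    hsupp.trans hLU, h1, h01⟩

/-- Multiplication by a cutoff extends functions that are regular on an open set. -/
theorem contDiff_smul_of_tsupport_subset {F : Type*} [NormedAddCommGroup F] [NormedSpace ℝ F]
    {U : Set E} (hU : IsOpen U) {χ : E → ℝ} {V : E → F} (hχ : ContDiff ℝ ∞ χ)
    (hχU : tsupport χ ⊆ U) (hV : ContDiffOn ℝ 1 V U) : ContDiff ℝ 1 fun x => χ x • V x := by
  refine contDiff_iff_contDiffAt.2 fun x => ?_
  by_cases hx : x ∈ tsupport χ
  · exact (hχ.contDiffAt.of_le (by exact_mod_cast le_top)).smul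
      (hV.contDiffAt (hU.mem_nhds (hχU hx)))
  · have : (fun x => χ x • V x) =ᶠ[𝓝 x] fun _ => 0 := by
      filter_upwards [notMem_tsupport_iff_eventuallyEq.1 hx] with y hy
      simp [hy]
    exact contDiffAt_const.congr_of_eventuallyEq this

/-- A `C¹` vector field on an open set has a globally Lipschitz modification with a global flow
that agrees with it near a given compact set. -/
theorem exists_isGlobalFlow_eq_nhdsSet [FiniteDimensional ℝ E] {K U : Set E} (hK : IsCompact K) (hU : IsOpen U)
    (hKU : K ⊆ U) {V : E → E} (hV : ContDiffOn ℝ 1 V U) :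
    ∃ (W : E → E) (L : NNReal) (Φ : ℝ → E → E) (O : Set E), LipschitzWith L W ∧
      IsGlobalFlow W Φ ∧ IsOpen O ∧ K ⊆ O ∧ O ⊆ U ∧ ∀ x ∈ O, W x = V x := by
  obtain ⟨χ, hχ, hχc, hχU, hχ1, -⟩ := exists_contDiff_cutoff hK hU hKU
  have hW := contDiff_smul_of_tsupport_subset hU hχ hχU hV
  have hWc : HasCompactSupport fun x => χ x • V x := hχc.smul_right
  obtain ⟨L, hL⟩ := hW.lipschitzWith_of_hasCompactSupport hWc one_ne_zero
  obtain ⟨M, hM⟩ := hWc.exists_bound_of_continuous hW.continuous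
  obtain ⟨Φ, hΦ⟩ := exists_isGlobalFlow (L := M.toNNReal) hL
    (fun x => (hM x).trans (Real.le_coe_toNNReal M))
  obtain ⟨O, hO, hKO, h1⟩ := eventually_nhdsSet_iff_exists.1 hχ1
  exact ⟨_, L, Φ, O ∩ U, hL, hΦ, hO.inter hU, subset_inter hKO hKU, inter_subset_right,
    fun x hx => by simp [h1 x hx.1]⟩

end Cutoff

end

/-! ### The stationary Liouville equation with Lipschitz test functions -/

section

variable {n : ℕ}

/-- `m` is a weak stationary solution in `U` of the Liouville equation of `V`. -/
def IsLiouvilleStationary (V : Eucl n → Eucl n) (U : Set (Eucl n)) (m : Measure (Eucl n)) : Prop :=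
  m Uᶜ = 0 ∧ ∀ f : Eucl n → ℝ, IsTestFunction U f → ∫ x, fderiv ℝ f x (V x) ∂m = 0

/-- The mollification of a function by the normed bump function `φ`. -/
noncomputable def mollify (φ : ContDiffBump (0 : Eucl n)) (h : Eucl n → ℝ) (x : Eucl n) : ℝ :=
  ∫ y, φ.normed volume y * h (x - y)

theorem contDiff_mollify (φ : ContDiffBump (0 : Eucl n)) {h : Eucl n → ℝ} (hh : Continuous h) :
    ContDiff ℝ ∞ (mollify φ h) :=
  φ.hasCompactSupport_normed.contDiff_convolution_left (ContinuousLinearMap.mul ℝ ℝ)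
    φ.contDiff_normed hh.locallyIntegrable

theorem tsupport_mollify_subset (φ : ContDiffBump (0 : Eucl n)) (h : Eucl n → ℝ) :
    tsupport (mollify φ h) ⊆ Metric.cthickening φ.rOut (tsupport h) := by
  refine closure_minimal (fun x hx => ?_) Metric.isClosed_cthickening
  by_contra hx'
  refine hx (integral_eq_zero_of_ae (Eventually.of_forall fun y => ?_))
  by_contra hy
  obtain ⟨h1, h2⟩ := mul_ne_zero_iff.1 hy
  have hy' : y ∈ Metric.ball 0 φ.rOut := by
    rw [← φ.support_normed_eq (μ := volume)]
    exact h1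
  refine hx' (Metric.mem_cthickening_of_dist_le x (x - y) _ _ (subset_closure h2) ?_)
  rw [dist_eq_norm, sub_sub_cancel]
  exact (mem_ball_zero_iff.1 hy').le

/-- Rademacher's theorem, transported by `y ↦ x - y`, which preserves Lebesgue null sets. -/
theorem ae_differentiableAt_sub {h : Eucl n → ℝ} {C : NNReal} (hh : LipschitzWith C h)
    (x : Eucl n) : ∀ᵐ y, DifferentiableAt ℝ h (x - y) :=
  (quasiMeasurePreserving_sub_left volume x).ae hh.ae_differentiableAt

/-- The derivative is put on `h` instead of on the kernel, since it is the derivative of `h` along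
the field that is known. The Lipschitz constant provides the domination. -/
theorem hasFDerivAt_mollify (φ : ContDiffBump (0 : Eucl n)) {h : Eucl n → ℝ} {C : NNReal}
    (hh : LipschitzWith C h) (x : Eucl n) :
    Integrable (fun y => φ.normed volume y • fderiv ℝ h (x - y)) ∧
    HasFDerivAt (mollify φ h) (∫ y, φ.normed volume y • fderiv ℝ h (x - y)) x := by
  refine hasFDerivAt_integral_of_dominated_loc_of_lip' (s := univ) (𝕜 := ℝ)
    (F := fun x y => φ.normed volume y * h (x - y))
    (bound := fun y => φ.normed volume y * C) univ_mem ?_ ?_ ?_ ?_ ?_ ?_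
  · intro z _
    exact (φ.continuous_normed.mul (hh.continuous.comp (by fun_prop))).aestronglyMeasurable
  · exact (φ.continuous_normed.mul (hh.continuous.comp (by fun_prop))).integrable_of_hasCompactSupport
      φ.hasCompactSupport_normed.mul_right
  · exact φ.continuous_normed.aestronglyMeasurable.smul
      ((measurable_fderiv ℝ h).comp (by fun_prop)).aestronglyMeasurable
  · refine Eventually.of_forall fun y z _ => ?_
    rw [← mul_sub, norm_mul, Real.norm_of_nonneg (φ.nonneg_normed y), mul_assoc]
    refine mul_le_mul_of_nonneg_left ?_ (φ.nonneg_normed y)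
    simpa [dist_eq_norm] using hh.dist_le_mul (z - y) (x - y)
  · exact φ.integrable_normed.mul_const _
  · filter_upwards [ae_differentiableAt_sub hh x] with y hy
    have : HasFDerivAt (fun z => h (z - y)) (fderiv ℝ h (x - y)) x := by
      simpa [Function.comp_def] using hy.hasFDerivAt.comp x ((hasFDerivAt_id x).sub_const y)
    exact this.const_mul _

theorem fderiv_mollify_apply (φ : ContDiffBump (0 : Eucl n)) {h : Eucl n → ℝ} {C : NNReal}
    (hh : LipschitzWith C h) (x v : Eucl n) :
    fderiv ℝ (mollify φ h) x v = ∫ y, φ.normed volume y * fderiv ℝ h (x - y) v := by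
  obtain ⟨hi, hd⟩ := hasFDerivAt_mollify φ hh x
  rw [hd.fderiv, ContinuousLinearMap.integral_apply hi]
  rfl

/-- The derivative of the mollification averages the a.e. derivatives of `h` over a small ball.
Taking `c = 0` gives a uniform bound, and `c = ℓ x` gives convergence. -/
theorem abs_fderiv_mollify_sub_le (φ : ContDiffBump (0 : Eucl n)) {h : Eucl n → ℝ} {C : NNReal}
    (hh : LipschitzWith C h) (x v : Eucl n) (c δ : ℝ)
    (H : ∀ z ∈ Metric.ball x φ.rOut, DifferentiableAt ℝ h z → |fderiv ℝ h z v - c| ≤ δ) :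
    |fderiv ℝ (mollify φ h) x v - c| ≤ δ := by
  have hi := (hasFDerivAt_mollify φ hh x).1
  have hi' : Integrable fun y => φ.normed volume y * fderiv ℝ h (x - y) v := hi.apply_continuousLinearMap v
  have hφ : Integrable (φ.normed (volume : Measure (Eucl n))) := φ.integrable_normed
  have hc : fderiv ℝ (mollify φ h) x v - c
      = ∫ y, φ.normed volume y * (fderiv ℝ h (x - y) v - c) := by
    simp_rw [mul_sub]
    rw [integral_sub hi' (hφ.mul_const c), integral_mul_const, φ.integral_normed, one_mul,
      fderiv_mollify_apply φ hh]
  have hδ : δ = ∫ y, φ.normed volume y * δ := by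
    rw [integral_mul_const, φ.integral_normed, one_mul]
  rw [hc, hδ, ← Real.norm_eq_abs]
  refine norm_integral_le_of_norm_le (hφ.mul_const δ) ?_
  filter_upwards [ae_differentiableAt_sub hh x] with y hy
  rw [norm_mul, Real.norm_of_nonneg (φ.nonneg_normed y)]
  by_cases hy0 : φ.normed (volume : Measure (Eucl n)) y = 0
  · simp [hy0]
  · have hyb : y ∈ Metric.ball 0 φ.rOut := by
      rw [← φ.support_normed_eq (μ := volume)]
      exact hy0
    refine mul_le_mul_of_nonneg_left (H _ ?_ hy) (φ.nonneg_normed y)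
    rw [Metric.mem_ball, dist_eq_norm, sub_sub_cancel_left, norm_neg]
    exact mem_ball_zero_iff.1 hyb

theorem ae_mem_of_compl_null {U : Set (Eucl n)} {m : Measure (Eucl n)} (hm : m Uᶜ = 0) :
    ∀ᵐ x ∂m, x ∈ U := by
  rwa [ae_iff]

/-- Lipschitz functions with compact support are admissible in the stationary Liouville equation,
as soon as their derivative along the field has a continuous version. -/
theorem IsLiouvilleStationary.integral_eq_zero {U : Set (Eucl n)} (hU : IsOpen U)
    {V : Eucl n → Eucl n} (hV : ContinuousOn V U) {m : Measure (Eucl n)} [IsFiniteMeasure m]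
    (hm : IsLiouvilleStationary V U m) {h ℓ : Eucl n → ℝ} {C : NNReal} (hh : LipschitzWith C h)
    (hc : HasCompactSupport h) (hhU : tsupport h ⊆ U) (hℓ : ContinuousOn ℓ U)
    (hd : ∀ x ∈ U, DifferentiableAt ℝ h x → fderiv ℝ h x (V x) = ℓ x) :
    ∫ x, ℓ x ∂m = 0 := by
  obtain ⟨r, hr, hrU⟩ := hc.exists_cthickening_subset_open hU hhU
  set K := Metric.cthickening r (tsupport h) with hK
  have hKc : IsCompact K := hc.isCompact.cthickening
  obtain ⟨B, hB0, hB⟩ := (hKc.image_of_continuousOn (hV.mono hrU)).isBounded.exists_pos_norm_le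
  let φ : ℕ → ContDiffBump (0 : Eucl n) := fun k =>
    ⟨r / (k + 1) / 2, r / (k + 1), by positivity, half_lt_self (by positivity)⟩
  have hφr : ∀ k, (φ k).rOut = r / (k + 1) := fun _ => rfl
  have hφ0 : Tendsto (fun k => (φ k).rOut) atTop (𝓝 0) := by
    simpa [hφr, div_eq_mul_inv] using
      (tendsto_one_div_add_atTop_nhds_zero_nat (𝕜 := ℝ)).const_mul r
  have hφK : ∀ k, tsupport (mollify (φ k) h) ⊆ K := fun k =>
    (tsupport_mollify_subset _ _).trans (Metric.cthickening_mono (by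
      rw [hφr]
      exact div_le_self hr.le (by linarith [Nat.cast_nonneg (α := ℝ) k])) _)
  have htest : ∀ k, IsTestFunction U (mollify (φ k) h) := fun k =>
    ⟨contDiff_mollify _ hh.continuous, hKc.of_isClosed_subset (isClosed_tsupport _) (hφK k),
      (hφK k).trans hrU⟩
  have hmU : m.restrict U = m := Measure.restrict_eq_self_of_ae_mem (ae_mem_of_compl_null hm.1)
  have hlim : Tendsto (fun k => ∫ x, fderiv ℝ (mollify (φ k) h) x (V x) ∂m) atTop
      (𝓝 (∫ x, ℓ x ∂m)) := by
    refine tendsto_integral_of_dominated_convergence (fun _ => C * B) (fun k => ?_)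
      (integrable_const _) (fun k => Eventually.of_forall fun x => ?_) ?_
    · rw [← hmU]
      refine ContinuousOn.aestronglyMeasurable ?_ hU.measurableSet
      exact (((htest k).1.continuous_fderiv (by simp)).continuousOn).clm_apply hV
    · by_cases hx : x ∈ K
      · have hCB : (C : ℝ) * ‖V x‖ ≤ C * B :=
          mul_le_mul_of_nonneg_left (hB _ (mem_image_of_mem V hx)) C.2
        have := abs_fderiv_mollify_sub_le (φ k) hh x (V x) 0 (C * B) (fun z _ _ => by
          rw [sub_zero, ← Real.norm_eq_abs]
          exact ((fderiv ℝ h z).le_of_opNorm_le (norm_fderiv_le_of_lipschitz ℝ hh) _).trans hCB)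
        simpa using this
      · have h0 : fderiv ℝ (mollify (φ k) h) x = 0 :=
          image_eq_zero_of_notMem_tsupport fun hx' =>
            hx (hφK k (tsupport_fderiv_subset ℝ hx'))
        simpa [h0] using mul_nonneg C.2 hB0.le
    -- As `m` may charge Lebesgue null sets, convergence is needed at every `x ∈ U`, even where `h`
    -- is not differentiable. At nearby points `z` of differentiability, `V x` may be exchanged for
    -- `V z` at the cost `C * ‖V x - V z‖`, and then `hd` and the continuity of `ℓ` apply.
    · filter_upwards [ae_mem_of_compl_null hm.1] with x hx
      rw [Metric.tendsto_atTop']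
      intro δ hδ
      have hcont : Tendsto (fun z => C * ‖V x - V z‖ + |ℓ z - ℓ x|) (𝓝 x) (𝓝 0) := by
        have hVx := hV.continuousAt (hU.mem_nhds hx)
        have hℓx := hℓ.continuousAt (hU.mem_nhds hx)
        have : ContinuousAt (fun z => C * ‖V x - V z‖ + |ℓ z - ℓ x|) x := by fun_prop
        simpa [ContinuousAt] using this
      obtain ⟨ε, hε, hεx⟩ := Metric.eventually_nhds_iff_ball.1
        ((hcont.eventually (gt_mem_nhds (half_pos hδ))).and (hU.mem_nhds hx))
      obtain ⟨N, hN⟩ := eventually_atTop.1 (hφ0.eventually (gt_mem_nhds hε))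
      refine ⟨N, fun k hk => ?_⟩
      rw [Real.dist_eq]
      refine (abs_fderiv_mollify_sub_le (φ k) hh x (V x) (ℓ x) (δ / 2) fun z hz hzd => ?_).trans_lt
        (half_lt_self hδ)
      obtain ⟨h1, h2⟩ := hεx z (Metric.ball_subset_ball (hN k hk.le).le hz)
      have h3 : fderiv ℝ h z (V x) - ℓ x = fderiv ℝ h z (V x - V z) + (ℓ z - ℓ x) := by
        rw [map_sub, hd z h2 hzd]
        ring
      rw [h3]
      refine (abs_add_le _ _).trans (le_trans (add_le_add ?_ le_rfl) h1.le)
      exact (fderiv ℝ h z).le_of_opNorm_le (norm_fderiv_le_of_lipschitz ℝ hh) _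
  refine tendsto_nhds_unique hlim ?_
  simp only [fun k => hm.2 _ (htest k), tendsto_const_nhds]

end

/-! ### Invariance under the flow -/

section

variable {n : ℕ}

section Flow

variable {U : Set (Eucl n)} {V : Eucl n → Eucl n} {m : Measure (Eucl n)} [IsFiniteMeasure m]
  {W : Eucl n → Eucl n} {L : NNReal} {Φ : ℝ → Eucl n → Eucl n} {O : Set (Eucl n)}

/-- The `s`-derivative of `∫ f (Φ s x) ∂m` is the integral of `g ∘ Φ s`, which is a continuous
version of the derivative of the Lipschitz function `f ∘ Φ s` along `V`; so it vanishes. The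
condition `ht` keeps the support of `f ∘ Φ s` where `W = V`. -/
theorem IsLiouvilleStationary.integral_comp_flow (hm : IsLiouvilleStationary V U m)
    (hU : IsOpen U) (hV : ContinuousOn V U) (hW : LipschitzWith L W) (hΦ : IsGlobalFlow W Φ)
    (hOU : O ⊆ U) (hWV : ∀ x ∈ O, W x = V x) {f : Eucl n → ℝ} (hf : ContDiff ℝ ∞ f)
    (hfc : HasCompactSupport f) {t : ℝ}
    (ht : ∀ s ∈ uIcc 0 t, ∀ x ∈ tsupport f, Φ (-s) x ∈ O) :
    ∫ x, f (Φ t x) ∂m = ∫ x, f x ∂m := by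
  have hf1 : ContDiff ℝ 1 f := hf.of_le (by exact_mod_cast le_top)
  have hfd : Differentiable ℝ f := hf1.differentiable one_ne_zero
  set g : Eucl n → ℝ := fun x => fderiv ℝ f x (W x) with hg
  have hgcont : Continuous g := (hf1.continuous_fderiv one_ne_zero).clm_apply hW.continuous
  have hg0 : ∀ x, x ∉ tsupport f → g x = 0 := fun x hx => by
    have : fderiv ℝ f x = 0 := image_eq_zero_of_notMem_tsupport fun hx' =>
      hx (tsupport_fderiv_subset ℝ hx')
    simp [hg, this]
  obtain ⟨M, hM⟩ := (HasCompactSupport.intro hfc.isCompact hg0).exists_bound_of_continuous hgcont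
  obtain ⟨M', hM'⟩ := hfc.exists_bound_of_continuous hf.continuous
  have hΦc : ∀ s, Continuous (Φ s) := fun s => (hΦ.lipschitzWith hW s).continuous
  have hder : ∀ x s, HasDerivAt (fun s => f (Φ s x)) (g (Φ s x)) s := fun x s =>
    (hfd (Φ s x)).hasFDerivAt.comp_hasDerivAt s (hΦ.hasDerivAt x s)
  have hF : ∀ s, HasDerivAt (fun s => ∫ x, f (Φ s x) ∂m) (∫ x, g (Φ s x) ∂m) s := fun s =>
    (hasDerivAt_integral_of_dominated_loc_of_deriv_le (s := univ) (bound := fun _ => M) univ_mem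
      (Eventually.of_forall fun r => (hf.continuous.comp (hΦc r)).aestronglyMeasurable)
      (Integrable.of_bound (hf.continuous.comp (hΦc s)).aestronglyMeasurable M'
        (Eventually.of_forall fun x => hM' _))
      (hgcont.comp (hΦc s)).aestronglyMeasurable
      (Eventually.of_forall fun x r _ => hM _) (integrable_const _)
      (Eventually.of_forall fun x r _ => hder x r)).2
  have hzero : ∀ s ∈ uIcc 0 t, ∫ x, g (Φ s x) ∂m = 0 := by
    intro s hs
    obtain ⟨C, hC⟩ := hf1.lipschitzWith_of_hasCompactSupport hfc one_ne_zero
    have hsupp : tsupport (f ∘ Φ s) ⊆ Φ (-s) '' tsupport f := by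
      refine closure_minimal (fun x hx => ⟨Φ s x, subset_closure hx, hΦ.neg_apply_apply hW s x⟩) ?_
      exact (hfc.isCompact.image (hΦc (-s))).isClosed
    have hsuppO : tsupport (f ∘ Φ s) ⊆ O := by
      refine hsupp.trans ?_
      rintro _ ⟨x, hx, rfl⟩
      exact ht s hs x hx
    refine hm.integral_eq_zero hU hV (hC.comp (hΦ.lipschitzWith hW s))
      ((hfc.isCompact.image (hΦc (-s))).of_isClosed_subset (isClosed_tsupport _) hsupp)
      (hsuppO.trans hOU) (hgcont.comp (hΦc s)).continuousOn fun x _ hx => ?_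
    by_cases hxs : Φ s x ∈ tsupport f
    · have hxO : x ∈ O := by simpa [hΦ.neg_apply_apply hW] using ht s hs _ hxs
      -- The derivative of `r ↦ f (Φ s (Φ r x))` at `0` is computed twice: by the chain rule for `f
      -- ∘ Φ s`, and through the group law as the derivative of `f` along an orbit.
      -- Differentiability of `Φ s` in space is never needed.
      have h1 : HasDerivAt (fun r => f (Φ s (Φ r x))) (fderiv ℝ (f ∘ Φ s) x (V x)) 0 := by
        have h0 := hΦ.hasDerivAt x 0
        rw [hΦ.map_zero, hWV x hxO] at h0
        have hx' : HasFDerivAt (f ∘ Φ s) (fderiv ℝ (f ∘ Φ s) x) (Φ 0 x) := by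
          rw [hΦ.map_zero]
          exact hx.hasFDerivAt
        exact HasFDerivAt.comp_hasDerivAt (f := fun r => Φ r x) 0 hx' h0
      have h2 : HasDerivAt (fun r => f (Φ s (Φ r x))) (g (Φ s x)) 0 := by
        have := (hder x (s + 0)).comp_const_add s 0
        simpa only [add_zero, hΦ.map_add hW] using this
      exact h1.unique h2
    · have h0 : f ∘ Φ s =ᶠ[𝓝 x] 0 := by
        filter_upwards [(hΦc s).continuousAt.eventually
          ((isClosed_tsupport f).isOpen_compl.mem_nhds hxs)] with y hy
        exact image_eq_zero_of_notMem_tsupport (f := f) hy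
      rw [h0.fderiv_eq, hg0 _ hxs]
      simp
  have hcst := (convex_uIcc (0 : ℝ) t).norm_image_sub_le_of_norm_hasDerivWithin_le (C := 0)
    (fun s _ => (hF s).hasDerivWithinAt) (fun s hs => by rw [hzero s hs, norm_zero])
    left_mem_uIcc right_mem_uIcc
  rw [zero_mul, norm_le_zero_iff, sub_eq_zero] at hcst
  simpa only [hΦ.map_zero] using hcst

theorem IsLiouvilleStationary.measure_image_flow (hm : IsLiouvilleStationary V U m)
    (hU : IsOpen U) (hV : ContinuousOn V U) (hW : LipschitzWith L W) (hΦ : IsGlobalFlow W Φ)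
    (hO : IsOpen O) (hOU : O ⊆ U) (hWV : ∀ x ∈ O, W x = V x) {B K : Set (Eucl n)}
    (hB : IsCompact B) (hK : IsCompact K) (hKO : K ⊆ O) {t : ℝ}
    (ht : ∀ s ∈ uIcc 0 t, ∀ x ∈ B, Φ s x ∈ K) :
    m (Φ t '' B) = m B := by
  have hΦc : ∀ s, Continuous (Φ s) := fun s => (hΦ.lipschitzWith hW s).continuous
  obtain ⟨δ, hδ, hδO⟩ := hK.exists_thickening_subset_open hO hKO
  -- By Grönwall distances grow at most by the factor `exp (L * |t|)`, so orbits from the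
  -- `r`-neighbourhood of `B` stay within `δ` of `K`, hence in `O`.
  set r := δ / Real.exp (L * |t|) with hr
  have hr0 : 0 < r := by positivity
  have hrk : ∀ k : ℕ, 0 < r / (k + 1) := fun k => by positivity
  choose f hf hfc hft hf1 hf01 using fun k : ℕ =>
    exists_contDiff_cutoff hB Metric.isOpen_thickening (Metric.self_subset_thickening (hrk k) B)
  -- Time `-t` is used because `f k ∘ Φ (-t)` tends to the indicator of `Φ t '' B`.
  have hinv : ∀ k, ∫ x, f k (Φ (-t) x) ∂m = ∫ x, f k x ∂m := by
    intro k
    refine hm.integral_comp_flow hU hV hW hΦ hOU hWV (hf k) (hfc k) fun s hs x hx => hδO ?_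
    obtain ⟨y, hy, hxy⟩ := Metric.mem_thickening_iff.1 (hft k hx)
    have hs' : -s ∈ uIcc 0 t := by
      rw [mem_uIcc] at hs ⊢
      rcases hs with h | h
      · right; constructor <;> linarith [h.1, h.2]
      · left; constructor <;> linarith [h.1, h.2]
    refine Metric.mem_thickening_iff.2 ⟨Φ (-s) y, ht _ hs' y hy, ?_⟩
    have hst : |-s| ≤ |t| := by simpa using abs_sub_left_of_mem_uIcc hs'
    calc dist (Φ (-s) x) (Φ (-s) y) ≤ dist x y * Real.exp (L * |-s|) := hΦ.dist_le hW _ _ _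
      _ ≤ dist x y * Real.exp (L * |t|) := by gcongr
      _ < r * Real.exp (L * |t|) := by
        refine mul_lt_mul_of_pos_right (hxy.trans_le ?_) (Real.exp_pos _)
        exact div_le_self hr0.le (by linarith [Nat.cast_nonneg (α := ℝ) k])
      _ = δ := by rw [hr]; field_simp
  have hpt : ∀ x, Tendsto (fun k => f k x) atTop (𝓝 (B.indicator (fun _ => (1 : ℝ)) x)) := by
    intro x
    by_cases hx : x ∈ B
    · rw [indicator_of_mem hx]
      simp only [fun k => (hf1 k).self_of_nhdsSet _ hx, tendsto_const_nhds]
    · rw [indicator_of_notMem hx]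
      obtain ⟨ε, hε, hεB⟩ := Metric.isOpen_iff.1 hB.isClosed.isOpen_compl x hx
      have hlim : Tendsto (fun k : ℕ => r / (k + 1)) atTop (𝓝 0) := by
        simpa [div_eq_mul_inv] using
          (tendsto_one_div_add_atTop_nhds_zero_nat (𝕜 := ℝ)).const_mul r
      refine tendsto_const_nhds.congr' ?_
      filter_upwards [hlim.eventually (gt_mem_nhds hε)] with k hk
      refine (image_eq_zero_of_notMem_tsupport fun hx' => ?_).symm
      obtain ⟨y, hy, hxy⟩ := Metric.mem_thickening_iff.1 (hft k hx')
      exact hεB (Metric.mem_ball'.2 (hxy.trans hk)) hy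
  have hbd : ∀ k x, ‖f k x‖ ≤ 1 := fun k x => by
    rw [Real.norm_of_nonneg (hf01 k x).1]
    exact (hf01 k x).2
  have hlim : ∀ s, Tendsto (fun k => ∫ x, f k (Φ s x) ∂m) atTop
      (𝓝 (m.real (Φ s ⁻¹' B))) := by
    intro s
    have hmeas : MeasurableSet (Φ s ⁻¹' B) := (hΦc s).measurable hB.measurableSet
    have : m.real (Φ s ⁻¹' B) = ∫ x, B.indicator (fun _ => (1 : ℝ)) (Φ s x) ∂m := by
      rw [← integral_indicator_one hmeas]
      rfl
    rw [this]
    exact tendsto_integral_of_dominated_convergence (fun _ => 1)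
      (fun k => ((hf k).continuous.comp (hΦc s)).aestronglyMeasurable) (integrable_const _)
      (fun k => Eventually.of_forall fun x => hbd k _) (Eventually.of_forall fun x => hpt _)
  have himg : Φ (-t) ⁻¹' B = Φ t '' B := by
    ext x
    refine ⟨fun hx => ⟨_, hx, hΦ.apply_neg_apply hW t x⟩, ?_⟩
    rintro ⟨y, hy, rfl⟩
    simpa [hΦ.neg_apply_apply hW] using hy
  have h0 : Φ 0 ⁻¹' B = B := by
    ext x
    simp [hΦ.map_zero]
  have heq := tendsto_nhds_unique (hlim (-t)) (by simpa [hinv, hΦ.map_zero, h0] using hlim 0)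
  rw [himg] at heq
  exact (measureReal_eq_measureReal_iff).1 heq

end Flow

/-! ### From global flows to the local flow -/

section LocalFlow

variable {U : Set (Eucl n)} {V : Eucl n → Eucl n} {ξ : Eucl n} {s t : ℝ} {γ : ℝ → Eucl n}

theorem IsSolutionUpTo.mono (hγ : IsSolutionUpTo V U ξ t γ) (hs : s ∈ uIcc 0 t) :
    IsSolutionUpTo V U ξ s γ :=
  have h := uIcc_subset_uIcc_left hs
  ⟨hγ.1, fun r hr => hγ.2.1 r (h hr), hγ.2.2.mono h⟩

theorem IsSolutionUpTo.isCompact_image (hγ : IsSolutionUpTo V U ξ t γ) :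
    IsCompact (γ '' uIcc 0 t) :=
  isCompact_uIcc.image_of_continuousOn hγ.2.2.continuousOn

/-- Both trajectories are compact, so they also solve the equation of a globally Lipschitz field
that agrees with `V` near them. -/
theorem isSolutionUpTo_eqOn (hU : IsOpen U) (hV : ContDiffOn ℝ 1 V U) {γ' : ℝ → Eucl n}
    (hγ : IsSolutionUpTo V U ξ t γ) (hγ' : IsSolutionUpTo V U ξ t γ') :
    EqOn γ γ' (uIcc 0 t) := by
  obtain ⟨W, L, Φ, O, hW, hΦ, -, hKO, -, hWV⟩ := exists_isGlobalFlow_eq_nhdsSet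
    (hγ.isCompact_image.union hγ'.isCompact_image) hU
    (union_subset (image_subset_iff.2 hγ.2.1) (image_subset_iff.2 hγ'.2.1)) hV
  refine eqOn_uIcc_of_isIntegralCurveOn hW (fun r hr => ?_) (fun r hr => ?_)
    (hγ.1.trans hγ'.1.symm)
  · simp only [hWV _ (hKO (Or.inl (mem_image_of_mem γ hr)))]
    exact hγ.2.2 r hr
  · simp only [hWV _ (hKO (Or.inr (mem_image_of_mem γ' hr)))]
    exact hγ'.2.2 r hr

theorem IsSolutionUpTo.localFlow_eq (hU : IsOpen U) (hV : ContDiffOn ℝ 1 V U)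
    (hγ : IsSolutionUpTo V U ξ t γ) (hs : s ∈ uIcc 0 t) : localFlow V U s ξ = γ s := by
  have h : ∃ γ, IsSolutionUpTo V U ξ s γ := ⟨γ, hγ.mono hs⟩
  rw [localFlow, dif_pos h]
  exact isSolutionUpTo_eqOn hU hV h.choose_spec (hγ.mono hs) right_mem_uIcc

theorem IsSolutionUpTo.shift (hγ : IsSolutionUpTo V U ξ t γ) (hs : s ∈ uIcc 0 t) {r : ℝ}
    (hr : r + s ∈ uIcc 0 t) : IsSolutionUpTo V U (γ s) r fun u => γ (u + s) := by
  have h : MapsTo (fun u => u + s) (uIcc 0 r) (uIcc 0 t) := by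
    intro u hu
    have : u + s ∈ uIcc s (r + s) := by
      rw [mem_uIcc] at hu ⊢
      rcases hu with h | h
      · left; constructor <;> linarith [h.1, h.2]
      · right; constructor <;> linarith [h.1, h.2]
    exact uIcc_subset_uIcc hs hr this
  refine ⟨by simp, fun u hu => hγ.2.1 _ (h hu), fun u hu => ?_⟩
  have := (hγ.2.2 (u + s) (h hu)).scomp u ((hasDerivWithinAt_id u (uIcc 0 r)).add_const s) h
  simpa [Function.comp_def] using this

theorem localFlow_localFlow (hU : IsOpen U) (hV : ContDiffOn ℝ 1 V U)
    (ht : t ∈ existenceInterval V U ξ) (hs : s ∈ uIcc 0 t) {r : ℝ} (hr : r + s ∈ uIcc 0 t) :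
    localFlow V U r (localFlow V U s ξ) = localFlow V U (r + s) ξ := by
  obtain ⟨γ, hγ⟩ := ht
  rw [hγ.localFlow_eq hU hV hs, hγ.localFlow_eq hU hV hr,
    (hγ.shift hs hr).localFlow_eq hU hV right_mem_uIcc]

theorem localFlow_mem (hU : IsOpen U) (hV : ContDiffOn ℝ 1 V U)
    (ht : t ∈ existenceInterval V U ξ) : localFlow V U t ξ ∈ U := by
  obtain ⟨γ, hγ⟩ := ht
  rw [hγ.localFlow_eq hU hV right_mem_uIcc]
  exact hγ.2.1 t right_mem_uIcc

/-- An open set is the union of an increasing sequence of compact sets that absorbs all its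
compact subsets. -/
theorem exists_compact_exhaustion (hU : IsOpen U) :
    ∃ K : ℕ → Set (Eucl n), Monotone K ∧ (∀ j, IsCompact (K j)) ∧ (∀ j, K j ⊆ U) ∧
      ∀ C ⊆ U, IsCompact C → ∃ j, C ⊆ K j := by
  have : LocallyCompactSpace U := hU.locallyCompactSpace
  let κ := CompactExhaustion.choice U
  refine ⟨fun j => Subtype.val '' κ j, fun i j hij => image_mono (κ.subset hij),
    fun j => (κ.isCompact j).image continuous_subtype_val, fun j => by
      rintro _ ⟨x, -, rfl⟩
      exact x.2, fun C hCU hC => ?_⟩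
  have hC' : IsCompact (Subtype.val ⁻¹' C : Set U) :=
    Topology.IsInducing.subtypeVal.isCompact_preimage_iff (by simpa using hCU) |>.2 hC
  obtain ⟨j, hj⟩ := κ.exists_superset_of_isCompact hC'
  exact ⟨j, fun x hx => ⟨⟨x, hCU hx⟩, hj hx, rfl⟩⟩

/-- Weak solutions of the stationary Liouville equation are preserved by the local flow. -/
theorem IsLiouvilleStationary.measure_image_localFlow {m : Measure (Eucl n)} [IsFiniteMeasure m]
    (hm : IsLiouvilleStationary V U m) (hU : IsOpen U) (hV : ContDiffOn ℝ 1 V U)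
    {B : Set (Eucl n)} (hB : IsSigmaCompact B) (ht : ∀ x ∈ B, t ∈ existenceInterval V U x) :
    IsSigmaCompact (localFlow V U t '' B) ∧ m (localFlow V U t '' B) = m B := by
  obtain ⟨K, hKmono, hKc, hKU, hKex⟩ := exists_compact_exhaustion hU
  obtain ⟨b, hbc, hbB⟩ := hB
  -- Points whose orbit segment stays in `K j`: on `D j` the local flow is the restriction of a
  -- single global flow, and the sets `D j` increase to `B`.
  set D : ℕ → Set (Eucl n) := fun j =>
    {x ∈ accumulate b j | ∀ s ∈ uIcc 0 t, localFlow V U s x ∈ K j} with hD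
  have haB : ∀ j, accumulate b j ⊆ B := fun j => by
    rw [← hbB]
    exact accumulate_subset_iUnion j
  have hDB : ∀ j, D j ⊆ B := fun j x hx => haB j hx.1
  have hDmono : Monotone D := fun i j hij x hx =>
    ⟨monotone_accumulate hij hx.1, fun s hs => hKmono hij (hx.2 s hs)⟩
  have hDU : ⋃ j, D j = B := by
    refine (iUnion_subset hDB).antisymm fun x hx => ?_
    obtain ⟨γ, hγ⟩ := ht x hx
    obtain ⟨j, hj⟩ := hKex _ (image_subset_iff.2 hγ.2.1) hγ.isCompact_image
    obtain ⟨i, hi⟩ := mem_iUnion.1 (hbB.symm ▸ hx : x ∈ ⋃ i, b i)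
    refine mem_iUnion.2 ⟨max i j, monotone_accumulate (le_max_left i j)
      (subset_accumulate hi), fun s hs => ?_⟩
    rw [hγ.localFlow_eq hU hV hs]
    exact hKmono (le_max_right i j) (hj (mem_image_of_mem γ hs))
  have key : ∀ j, IsCompact (localFlow V U t '' D j) ∧ m (localFlow V U t '' D j) = m (D j) := by
    intro j
    obtain ⟨W, L, Φ, O, hW, hΦ, hO, hKO, hOU, hWV⟩ :=
      exists_isGlobalFlow_eq_nhdsSet (hKc j) hU (hKU j) hV
    have hΦc : ∀ s, Continuous (Φ s) := fun s => (hΦ.lipschitzWith hW s).continuous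
    have hflow : ∀ x ∈ D j, ∀ s ∈ uIcc 0 t, localFlow V U s x = Φ s x := by
      intro x hx s hs
      obtain ⟨γ, hγ⟩ := ht x (hDB j hx)
      have hW' : IsIntegralCurveOn γ (fun _ => W) (uIcc 0 t) := fun r hr => by
        have := hx.2 r hr
        rw [hγ.localFlow_eq hU hV hr] at this
        simp only [hWV _ (hKO this)]
        exact hγ.2.2 r hr
      rw [hγ.localFlow_eq hU hV hs, hΦ.eq_of_isIntegralCurveOn hW hW' hs, hγ.1]
    -- In terms of the continuous maps `Φ s` the defining conditions are closed, which makes `D j`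
    -- compact. Conversely, a `Φ`-orbit segment inside `K j` solves the equation of `V`.
    have hDeq : D j = accumulate b j ∩ ⋂ s ∈ uIcc 0 t, Φ s ⁻¹' K j := by
      ext x
      refine ⟨fun hx => ⟨hx.1, mem_iInter₂.2 fun s hs => ?_⟩, fun hx => ⟨hx.1, fun s hs => ?_⟩⟩
      · rw [mem_preimage, ← hflow x hx s hs]
        exact hx.2 s hs
      · have hx2 := mem_iInter₂.1 hx.2
        have hsol : IsSolutionUpTo V U x t fun s => Φ s x :=
          ⟨hΦ.map_zero x, fun r hr => hKU j (hx2 r hr), fun r hr => by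
            simpa only [hWV _ (hKO (hx2 r hr))] using hΦ.isIntegralCurveOn x _ r hr⟩
        rw [hsol.localFlow_eq hU hV hs]
        exact hx2 s hs
    have hDc : IsCompact (D j) := by
      rw [hDeq]
      exact (isCompact_accumulate hbc j).inter_right
        (isClosed_biInter fun s _ => (hKc j).isClosed.preimage (hΦc s))
    have himg : localFlow V U t '' D j = Φ t '' D j :=
      image_congr fun x hx => hflow x hx t right_mem_uIcc
    rw [himg]
    exact ⟨hDc.image (hΦc t), hm.measure_image_flow hU hV.continuousOn hW hΦ hO hOU hWV hDc
      (hKc j) hKO fun s hs x hx => hflow x hx s hs ▸ hx.2 s hs⟩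
  rw [← hDU, image_iUnion]
  refine ⟨isSigmaCompact_iUnion_of_isCompact _ fun j => (key j).1, ?_⟩
  rw [hDmono.measure_iUnion, Monotone.measure_iUnion fun i j hij => image_mono (hDmono hij)]
  simp only [fun j => (key j).2]

end LocalFlow

end

/-! ### Rescaled smoothing kernels -/

section

/-- A smooth probability density supported in the unit ball. -/
noncomputable def unitBump (n : ℕ) : Eucl n → ℝ :=
  (⟨1 / 2, 1, by norm_num, by norm_num⟩ : ContDiffBump (0 : Eucl n)).normed volume

/-- The rescaling `ε⁻ⁿ η(w / ε)` of the standard density `η`. -/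
noncomputable def scaledBump {n : ℕ} (ε : ℝ) (w : Eucl n) : ℝ :=
  (ε ^ n)⁻¹ * unitBump n (ε⁻¹ • w)

/-- The derivative of `scaledBump` with respect to the scale. -/
noncomputable def scaledBumpDeriv {n : ℕ} (ε : ℝ) (w : Eucl n) : ℝ :=
  -(ε⁻¹ * (n * scaledBump ε w + (ε ^ n)⁻¹ * fderiv ℝ (unitBump n) (ε⁻¹ • w) (ε⁻¹ • w)))

variable {n : ℕ}

theorem contDiff_unitBump : ContDiff ℝ ∞ (unitBump n) := ContDiffBump.contDiff_normed _

theorem differentiable_unitBump : Differentiable ℝ (unitBump n) :=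
  contDiff_unitBump.differentiable (by simp)

theorem integral_unitBump : ∫ w, unitBump n w = 1 := ContDiffBump.integral_normed _

theorem unitBump_nonneg (w : Eucl n) : 0 ≤ unitBump n w := ContDiffBump.nonneg_normed _ _

theorem unitBump_eq_zero {w : Eucl n} (hw : 1 ≤ ‖w‖) : unitBump n w = 0 := by
  by_contra h
  have : w ∈ Function.support (unitBump n) := h
  rw [unitBump, ContDiffBump.support_normed_eq] at this
  exact absurd (mem_ball_zero_iff.1 this) (not_lt.2 hw)

theorem exists_unitBump_le (n : ℕ) : ∃ M, 0 ≤ M ∧ ∀ w : Eucl n, unitBump n w ≤ M := by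
  obtain ⟨M, hM⟩ := (ContDiffBump.hasCompactSupport_normed _ :
    HasCompactSupport (unitBump n)).exists_bound_of_continuous contDiff_unitBump.continuous
  exact ⟨M, (norm_nonneg _).trans (hM 0), fun w => (le_abs_self _).trans (hM w)⟩

theorem contDiff_scaledBump (ε : ℝ) : ContDiff ℝ ∞ (scaledBump ε : Eucl n → ℝ) :=
  contDiff_const.mul (contDiff_unitBump.comp (contDiff_const_smul _))

theorem scaledBump_eq_zero {ε : ℝ} (hε : 0 < ε) {w : Eucl n} (hw : ε ≤ ‖w‖) :
    scaledBump ε w = 0 := by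
  rw [scaledBump, unitBump_eq_zero, mul_zero]
  rw [norm_smul, norm_inv, Real.norm_of_nonneg hε.le, inv_mul_eq_div]
  exact (one_le_div hε).2 hw

theorem scaledBump_nonneg {ε : ℝ} (hε : 0 < ε) (w : Eucl n) : 0 ≤ scaledBump ε w :=
  mul_nonneg (by positivity) (unitBump_nonneg _)

theorem integral_scaledBump {ε : ℝ} (hε : 0 < ε) : ∫ w : Eucl n, scaledBump ε w = 1 := by
  simp only [scaledBump]
  rw [integral_const_mul, Measure.integral_comp_inv_smul, integral_unitBump,
    finrank_euclideanSpace_fin, abs_of_pos (by positivity)]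
  simp [hε.ne']

theorem hasDerivAt_scaledBump {ε : ℝ} (hε : 0 < ε) (w : Eucl n) :
    HasDerivAt (fun r => scaledBump r w) (scaledBumpDeriv ε w) ε := by
  have h1 : HasDerivAt (fun r : ℝ => (r ^ n)⁻¹) (-(n * ε ^ (n - 1)) / (ε ^ n) ^ 2) ε :=
    (hasDerivAt_pow n ε).inv (by positivity)
  have h2 : HasDerivAt (fun r : ℝ => r⁻¹ • w) (-(ε ^ 2)⁻¹ • w) ε :=
    (hasDerivAt_inv hε.ne').smul_const w
  have h3 := (differentiable_unitBump (ε⁻¹ • w)).hasFDerivAt.comp_hasDerivAt ε h2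
  refine (h1.mul h3).congr_deriv ?_
  simp only [scaledBumpDeriv, scaledBump, map_smul, smul_eq_mul, Function.comp_def]
  rcases n with _ | n
  · simp; field_simp
  · simp only [Nat.add_sub_cancel]
    push_cast
    field_simp
    ring

theorem continuousOn_scaledBumpDeriv :
    ContinuousOn (fun z : ℝ × Eucl n => scaledBumpDeriv z.1 z.2) (Ioi 0 ×ˢ univ) := by
  have hinv : ContinuousOn (fun z : ℝ × Eucl n => z.1⁻¹) (Ioi 0 ×ˢ univ) :=
    continuousOn_fst.inv₀ fun z hz => (ne_of_gt hz.1)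
  have hpow : ContinuousOn (fun z : ℝ × Eucl n => (z.1 ^ n)⁻¹) (Ioi 0 ×ˢ univ) :=
    (continuousOn_fst.pow n).inv₀ fun z hz => pow_ne_zero n (ne_of_gt hz.1)
  have hsm : ContinuousOn (fun z : ℝ × Eucl n => z.1⁻¹ • z.2) (Ioi 0 ×ˢ univ) :=
    hinv.smul continuousOn_snd
  have hη := (contDiff_unitBump (n := n)).continuous.comp_continuousOn hsm
  have hη' := ((contDiff_unitBump (n := n)).continuous_fderiv (by simp)).comp_continuousOn hsm
  exact (hinv.mul ((continuousOn_const.mul (hpow.mul hη)).add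
    (hpow.mul (hη'.clm_apply hsm)))).neg

/-- The test function in the representation of the derivative with respect to the scale. -/
noncomputable def scaledMoment (i : Fin n) (ε : ℝ) (w : Eucl n) : ℝ :=
  ε⁻¹ * (w i * scaledBump ε w)

theorem contDiff_scaledMoment (i : Fin n) (ε : ℝ) : ContDiff ℝ ∞ (scaledMoment i ε) :=
  contDiff_const.mul ((EuclideanSpace.proj (𝕜 := ℝ) i).contDiff.mul (contDiff_scaledBump ε))

/-- On the support `|w i| ≤ ε`, which cancels the factor `ε⁻¹`. -/
theorem abs_scaledMoment_le {M : ℝ} (hM : ∀ w : Eucl n, unitBump n w ≤ M) (i : Fin n) {ε : ℝ}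
    (hε : 0 < ε) (w : Eucl n) : |scaledMoment i ε w| ≤ (ε ^ n)⁻¹ * M := by
  have hM0 : 0 ≤ M := (unitBump_nonneg 0).trans (hM 0)
  rcases le_total ε ‖w‖ with hw | hw
  · rw [scaledMoment, scaledBump_eq_zero hε hw]
    simp; positivity
  · have h1 : |w i| ≤ ε := (PiLp.norm_apply_le w i).trans hw
    have h2 : scaledBump ε w ≤ (ε ^ n)⁻¹ * M :=
      mul_le_mul_of_nonneg_left (hM _) (by positivity)
    rw [scaledMoment, abs_mul, abs_mul, abs_of_pos (inv_pos.2 hε),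
      abs_of_nonneg (scaledBump_nonneg hε w)]
    calc ε⁻¹ * (|w i| * scaledBump ε w) ≤ ε⁻¹ * (ε * ((ε ^ n)⁻¹ * M)) := by
          gcongr
          exact scaledBump_nonneg hε w
      _ = (ε ^ n)⁻¹ * M := by field_simp

/-- The scale derivative of the kernel `η_ε` is a divergence, `∂_ε η_ε = -div (ε⁻¹ w η_ε)`. This
lets weak derivatives of `f` control how its averages vary with the scale. -/
theorem sum_partialDeriv_scaledMoment {ε : ℝ} (x y : Eucl n) :
    ∑ i, partialDeriv i (fun y => scaledMoment i ε (y - x)) y = -scaledBumpDeriv ε (y - x) := by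
  set w := y - x with hw
  have hη : HasFDerivAt (scaledBump ε : Eucl n → ℝ)
      ((ε ^ n)⁻¹ • (fderiv ℝ (unitBump n) (ε⁻¹ • w)).comp
        (ε⁻¹ • ContinuousLinearMap.id ℝ (Eucl n))) w :=
    ((differentiable_unitBump (ε⁻¹ • w)).hasFDerivAt.comp w
      ((hasFDerivAt_id w).const_smul ε⁻¹)).const_mul _
  have hi : ∀ i, partialDeriv i (fun y => scaledMoment i ε (y - x)) y
      = ε⁻¹ * (scaledBump ε w + (ε ^ n)⁻¹ * (fderiv ℝ (unitBump n) (ε⁻¹ • w)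
        (ε⁻¹ • w i • EuclideanSpace.single i 1))) := by
    intro i
    have h1 : HasFDerivAt (scaledMoment i ε) _ w :=
      (((EuclideanSpace.proj (𝕜 := ℝ) i).hasFDerivAt (x := w)).mul hη).const_mul ε⁻¹
    have h2 := h1.comp y ((hasFDerivAt_id y).sub_const x)
    have h3 : HasFDerivAt (fun y => scaledMoment i ε (y - x)) _ y := h2
    rw [partialDeriv, h3.fderiv]
    simp
    ring
  have hsum : ∑ i, w i • EuclideanSpace.single i (1 : ℝ) = w := by
    simpa using (EuclideanSpace.basisFun (Fin n) ℝ).sum_repr w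
  simp only [hi]
  rw [← Finset.mul_sum, Finset.sum_add_distrib, ← Finset.mul_sum, ← map_sum, ← Finset.smul_sum,
    hsum, scaledBumpDeriv]
  simp

/-- Hölder's inequality on `S`; the norm is then enlarged to the fixed set `K`, so that only the
volume of `S` depends on the scale. -/
theorem norm_setIntegral_mul_le {p A : ℝ} (hp : 1 ≤ p) {S K : Set (Eucl n)}
    {g ψ : Eucl n → ℝ} (hA : 0 ≤ A)
    (hgK : eLpNorm g (ENNReal.ofReal p) (volume.restrict K) ≠ ⊤) (hgS : IntegrableOn g S)
    (hS : volume S ≠ ⊤) (hSK : S ⊆ K) (hψ : ∀ y, |ψ y| ≤ A) :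
    |∫ y in S, g y * ψ y| ≤ A * ((eLpNorm g (ENNReal.ofReal p) (volume.restrict K)).toReal *
      volume.real S ^ (1 - 1 / p)) := by
  have h1 : |∫ y in S, g y * ψ y| ≤ ∫ y in S, A * ‖g y‖ := by
    rw [← Real.norm_eq_abs]
    refine norm_integral_le_of_norm_le (hgS.norm.const_mul A) (Eventually.of_forall fun y => ?_)
    rw [norm_mul, mul_comm]
    exact mul_le_mul_of_nonneg_right (hψ y) (norm_nonneg _)
  refine h1.trans ?_
  rw [integral_const_mul]
  refine mul_le_mul_of_nonneg_left ?_ hA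
  have hp' : (1 : ℝ≥0∞) ≤ ENNReal.ofReal p := by
    rw [← ENNReal.ofReal_one]
    exact ENNReal.ofReal_le_ofReal hp
  have h2 := eLpNorm_le_eLpNorm_mul_rpow_measure_univ hp' hgS.aestronglyMeasurable
  have h3 : eLpNorm g (ENNReal.ofReal p) (volume.restrict S)
      ≤ eLpNorm g (ENNReal.ofReal p) (volume.restrict K) :=
    eLpNorm_mono_measure g (Measure.restrict_mono hSK le_rfl)
  rw [integral_norm_eq_lintegral_enorm hgS.aestronglyMeasurable, ← eLpNorm_one_eq_lintegral_enorm,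
    Measure.real, ENNReal.toReal_rpow, ← ENNReal.toReal_mul]
  have hexp : 0 ≤ 1 - 1 / p := by
    rw [sub_nonneg, div_le_one (by linarith)]
    exact hp
  refine ENNReal.toReal_mono (ENNReal.mul_ne_top hgK (ENNReal.rpow_ne_top_of_nonneg hexp hS)) ?_
  refine h2.trans ?_
  rw [Measure.restrict_apply_univ, ENNReal.toReal_ofReal (by linarith), ENNReal.toReal_one, div_one]
  gcongr

end

/-! ### Morrey's inequality through averages at varying scale -/

section

variable {n : ℕ}

/-- The average of `f` at scale `ε` around `x`. -/
noncomputable def scaledAverage (R : ℝ) (f : Eucl n → ℝ) (x : Eucl n) (ε : ℝ) : ℝ :=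
  ∫ y in Metric.closedBall x R, f y * scaledBump ε (y - x)

theorem setIntegral_mul_scaledBump_eq {S : Set (Eucl n)} (hS : MeasurableSet S) {x : Eucl n}
    {ε : ℝ} (hxS : Metric.closedBall x ε ⊆ S) (g ψ : Eucl n → ℝ)
    (hψ : ∀ w, ε ≤ ‖w‖ → ψ w = 0) :
    ∫ y in S, g y * ψ (y - x) = ∫ y in Metric.closedBall x ε, g y * ψ (y - x) := by
  refine setIntegral_eq_of_subset_of_forall_sdiff_eq_zero hS hxS fun y hy => ?_
  rw [hψ, mul_zero]
  rw [← dist_eq_norm]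
  exact (not_le.1 hy.2).le

theorem setIntegral_closedBall_scaledBump {x : Eucl n} {ε R : ℝ} (hε : 0 < ε) (hR : ε ≤ R) :
    ∫ y in Metric.closedBall x R, scaledBump ε (y - x) = 1 := by
  rw [setIntegral_eq_integral_of_forall_compl_eq_zero, integral_sub_right_eq_self (scaledBump ε),
    integral_scaledBump hε]
  intro y hy
  refine scaledBump_eq_zero hε ?_
  rw [← dist_eq_norm]
  exact hR.trans (not_le.1 hy).le

theorem tendsto_scaledAverage {R : ℝ} (hR : 0 < R) {f : Eucl n → ℝ} {x : Eucl n}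
    (hf : ContinuousOn f (Metric.closedBall x R)) :
    Tendsto (scaledAverage R f x) (𝓝[>] 0) (𝓝 (f x)) := by
  have hfx : ContinuousAt f x := hf.continuousAt (Metric.closedBall_mem_nhds x hR)
  rw [Metric.tendsto_nhds]
  intro δ hδ
  obtain ⟨r, hr, hfr⟩ := Metric.continuousAt_iff.1 hfx (δ / 2) (half_pos hδ)
  filter_upwards [Ioo_mem_nhdsGT (lt_min hr hR)] with ε hε
  have hεr : ε < r := hε.2.trans_le (min_le_left _ _)
  have hεR : ε < R := hε.2.trans_le (min_le_right _ _)
  have hkc : Continuous fun y => scaledBump ε (y - x) :=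
    (contDiff_scaledBump ε).continuous.comp (by fun_prop)
  have hS : IsCompact (Metric.closedBall x R) := isCompact_closedBall x R
  have hki : IntegrableOn (fun y => scaledBump ε (y - x)) (Metric.closedBall x R) :=
    hkc.continuousOn.integrableOn_compact hS
  have hfi : IntegrableOn (fun y => f y * scaledBump ε (y - x)) (Metric.closedBall x R) :=
    (hf.mul hkc.continuousOn).integrableOn_compact hS
  have heq : scaledAverage R f x ε - f x
      = ∫ y in Metric.closedBall x R, (f y - f x) * scaledBump ε (y - x) := by
    simp_rw [sub_mul]
    rw [integral_sub hfi (hki.const_mul _), integral_const_mul,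
      setIntegral_closedBall_scaledBump hε.1 hεR.le, mul_one, scaledAverage]
  have h1 : δ / 2 = ∫ y in Metric.closedBall x R, δ / 2 * scaledBump ε (y - x) := by
    rw [integral_const_mul, setIntegral_closedBall_scaledBump hε.1 hεR.le, mul_one]
  rw [dist_eq_norm, heq]
  refine lt_of_le_of_lt ?_ (half_lt_self hδ)
  rw [h1]
  refine norm_integral_le_of_norm_le (hki.const_mul _) (Eventually.of_forall fun y => ?_)
  have hk0 := scaledBump_nonneg hε.1 (y - x)
  rw [norm_mul, Real.norm_of_nonneg hk0]
  by_cases hy : dist y x < r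
  · exact mul_le_mul_of_nonneg_right (hfr hy).le hk0
  · rw [scaledBump_eq_zero hε.1 (by rw [← dist_eq_norm]; linarith)]
    simp

theorem hasDerivAt_scaledAverage {R : ℝ} {f : Eucl n → ℝ} {x : Eucl n}
    (hf : ContinuousOn f (Metric.closedBall x R)) {ε : ℝ} (hε : 0 < ε) :
    HasDerivAt (scaledAverage R f x)
      (∫ y in Metric.closedBall x R, f y * scaledBumpDeriv ε (y - x)) ε := by
  have hS : IsCompact (Metric.closedBall x R) := isCompact_closedBall x R
  have hpos : ∀ r ∈ Icc (ε / 2) (2 * ε), 0 < r := fun r hr => (half_pos hε).trans_le hr.1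
  have hcont : ContinuousOn (fun z : ℝ × Eucl n => f z.2 * scaledBumpDeriv z.1 (z.2 - x))
      (Icc (ε / 2) (2 * ε) ×ˢ Metric.closedBall x R) := by
    refine (hf.comp continuousOn_snd fun z hz => hz.2).mul ?_
    exact continuousOn_scaledBumpDeriv.comp
      (f := fun z : ℝ × Eucl n => (z.1, z.2 - x)) (by fun_prop)
      fun z hz => ⟨hpos _ hz.1, mem_univ _⟩
  obtain ⟨M, hM⟩ := (isCompact_Icc.prod hS).exists_bound_of_continuousOn hcont
  have hkc : ∀ r, Continuous fun y => scaledBump r (y - x) := fun r =>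
    (contDiff_scaledBump r).continuous.comp (by fun_prop)
  have hi : ∀ r, IntegrableOn (fun y => f y * scaledBump r (y - x)) (Metric.closedBall x R) :=
    fun r => (hf.mul (hkc r).continuousOn).integrableOn_compact hS
  have hε' : ε ∈ Icc (ε / 2) (2 * ε) := ⟨by linarith, by linarith⟩
  refine (hasDerivAt_integral_of_dominated_loc_of_deriv_le (s := Icc (ε / 2) (2 * ε))
    (F := fun r y => f y * scaledBump r (y - x)) (bound := fun _ => M)
    (F' := fun r y => f y * scaledBumpDeriv r (y - x))
    (Icc_mem_nhds (by linarith) (by linarith))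
    (Eventually.of_forall fun r => (hi r).aestronglyMeasurable) (hi ε) ?_ ?_
    (integrableOn_const (isCompact_closedBall x R).measure_ne_top) ?_).2
  · refine ContinuousOn.aestronglyMeasurable ?_ hS.measurableSet
    exact hcont.comp (f := fun y => (ε, y)) (by fun_prop) fun y hy => ⟨hε', hy⟩
  · filter_upwards [ae_restrict_mem hS.measurableSet] with y hy r hr
    exact hM (r, y) ⟨hr, hy⟩
  · exact Eventually.of_forall fun y r hr => (hasDerivAt_scaledBump (hpos r hr) _).const_mul _

theorem isTestFunction_scaledMoment {U : Set (Eucl n)} {x : Eucl n} {ε : ℝ} (hε : 0 < ε)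
    (hxU : Metric.closedBall x ε ⊆ U) (i : Fin n) :
    IsTestFunction U fun y => scaledMoment i ε (y - x) := by
  have hsupp : tsupport (fun y => scaledMoment i ε (y - x)) ⊆ Metric.closedBall x ε := by
    refine closure_minimal (fun y hy => ?_) Metric.isClosed_closedBall
    by_contra h
    refine hy ?_
    simp only [scaledMoment]
    rw [scaledBump_eq_zero hε (by rw [← dist_eq_norm]; exact (not_le.1 h).le)]
    simp
  exact ⟨(contDiff_scaledMoment i ε).comp (by fun_prop),
    (isCompact_closedBall x ε).of_isClosed_subset (isClosed_tsupport _) hsupp, hsupp.trans hxU⟩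

/-- The definition of weak derivative, tested with `scaledMoment`; its minus sign cancels the one of
the divergence formula. -/
theorem integral_mul_scaledBumpDeriv {U : Set (Eucl n)} (hU : IsOpen U) {R ε : ℝ}
    {f : Eucl n → ℝ} {g : Fin n → Eucl n → ℝ} {x : Eucl n} (hf : ContinuousOn f U)
    (hfg : ∀ i, HasWeakPartial U i f (g i)) (hxU : Metric.closedBall x R ⊆ U) (hε : 0 < ε)
    (hεR : ε ≤ R) :
    ∫ y in Metric.closedBall x R, f y * scaledBumpDeriv ε (y - x)
      = ∑ i, ∫ y in Metric.closedBall x ε, g i y * scaledMoment i ε (y - x) := by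
  have hεU : Metric.closedBall x ε ⊆ U := (Metric.closedBall_subset_closedBall hεR).trans hxU
  have htest := isTestFunction_scaledMoment hε hεU
  have hsupp : ∀ i y, y ∉ Metric.closedBall x ε →
      partialDeriv i (fun y => scaledMoment i ε (y - x)) y = 0 := by
    intro i y hy
    have h0 : (fun y => scaledMoment i ε (y - x)) =ᶠ[𝓝 y] fun _ => 0 := by
      filter_upwards [Metric.isClosed_closedBall.isOpen_compl.mem_nhds hy] with z hz
      simp only [scaledMoment]
      rw [scaledBump_eq_zero hε (by rw [← dist_eq_norm]; exact (not_le.1 fun h => hz h).le)]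
      simp
    rw [partialDeriv, h0.fderiv_eq]
    simp
  have hi : ∀ i, IntegrableOn (fun y => f y * partialDeriv i
      (fun y => scaledMoment i ε (y - x)) y) (Metric.closedBall x R) := fun i => by
    refine ContinuousOn.integrableOn_compact (isCompact_closedBall x R) ((hf.mono hxU).mul ?_)
    exact (((htest i).1.continuous_fderiv (by simp)).clm_apply continuous_const).continuousOn
  have h1 : ∀ y, f y * scaledBumpDeriv ε (y - x) = -∑ i, f y * partialDeriv i
      (fun y => scaledMoment i ε (y - x)) y := fun y => by
    rw [← Finset.mul_sum, sum_partialDeriv_scaledMoment]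
    ring
  simp_rw [h1]
  rw [integral_neg, integral_finsetSum _ fun i _ => hi i, ← Finset.sum_neg_distrib]
  refine Finset.sum_congr rfl fun i _ => ?_
  have h2 : ∫ y in U, f y * partialDeriv i (fun y => scaledMoment i ε (y - x)) y
      = ∫ y in Metric.closedBall x R,
        f y * partialDeriv i (fun y => scaledMoment i ε (y - x)) y := by
    refine setIntegral_eq_of_subset_of_forall_sdiff_eq_zero hU.measurableSet hxU fun y hy => ?_
    rw [hsupp i y fun h => hy.2 (Metric.closedBall_subset_closedBall hεR h), mul_zero]
  rw [← h2, (hfg i).2.2 _ (htest i), neg_neg]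
  exact setIntegral_mul_scaledBump_eq hU.measurableSet hεU (g i) _ fun w hw => by
    rw [scaledMoment, scaledBump_eq_zero hε hw]
    simp

theorem abs_sub_le_sub_of_abs_deriv_le {F F' H H' : ℝ → ℝ} {a b : ℝ} (hab : a ≤ b)
    (hF : ∀ s ∈ Icc a b, HasDerivAt F (F' s) s) (hH : ∀ s ∈ Icc a b, HasDerivAt H (H' s) s)
    (hFH : ∀ s ∈ Icc a b, |F' s| ≤ H' s) : |F b - F a| ≤ H b - H a :=
  image_norm_le_of_norm_deriv_right_le_deriv_boundary' (a := a) (b := b)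
    (f := fun s => F s - F a) (B := fun s => H s - H a)
    (fun s hs => ((hF s hs).sub_const _).continuousAt.continuousWithinAt)
    (fun s hs => ((hF s (Ico_subset_Icc_self hs)).sub_const _).hasDerivWithinAt) (by simp)
    (fun s hs => ((hH s hs).sub_const _).continuousAt.continuousWithinAt)
    (fun s hs => ((hH s (Ico_subset_Icc_self hs)).sub_const _).hasDerivWithinAt)
    (fun s hs => hFH s (Ico_subset_Icc_self hs)) (right_mem_Icc.2 hab)

/-- Morrey's inequality: for `p > n`, a continuous function with weak partial derivatives is
bounded by its `W^{1,p}` norm on a neighbourhood of fixed size. -/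
theorem exists_abs_le_of_hasWeakPartial (hn : 0 < n) {p : ℝ} (hp : (n : ℝ) < p) {R : ℝ}
    (hR : 0 < R) :
    ∃ C : ℝ, 0 ≤ C ∧ ∀ (U K : Set (Eucl n)) (f : Eucl n → ℝ) (g : Fin n → Eucl n → ℝ) (x : Eucl n),
      IsOpen U → K ⊆ U → Metric.closedBall x R ⊆ K → ContinuousOn f U →
      (∀ i, HasWeakPartial U i f (g i)) →
      eLpNorm f (ENNReal.ofReal p) (volume.restrict K) ≠ ⊤ →
      (∀ i, eLpNorm (g i) (ENNReal.ofReal p) (volume.restrict K) ≠ ⊤) →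
      |f x| ≤ C * ((eLpNorm f (ENNReal.ofReal p) (volume.restrict K)).toReal +
        ∑ i, (eLpNorm (g i) (ENNReal.ofReal p) (volume.restrict K)).toReal) := by
  obtain ⟨M, hM0, hM⟩ := exists_unitBump_le n
  have hn1 : (1 : ℝ) ≤ n := by exact_mod_cast hn
  have hp1 : 1 ≤ p := hn1.trans hp.le
  have hp0 : 0 < p := by linarith
  -- Hölder on a ball of radius `ε` gives `ε^(-n) * ε^(n(1 - 1/p)) = ε^(θ - 1)`, which is integrable
  -- at `0` precisely because `p > n`.
  set θ : ℝ := 1 - n / p with hθ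
  have hθ0 : 0 < θ := by
    rw [hθ, sub_pos, div_lt_one hp0]
    exact hp
  set c : ℝ := volume.real (Metric.ball (0 : Eucl n) 1) ^ (1 - 1 / p) with hc
  have hc0 : 0 ≤ c := Real.rpow_nonneg measureReal_nonneg _
  have hvol : ∀ (x : Eucl n) (ε : ℝ), 0 < ε →
      (ε ^ n)⁻¹ * volume.real (Metric.closedBall x ε) ^ (1 - 1 / p) = c * ε ^ (θ - 1) := by
    intro x ε hε
    rw [Measure.addHaar_real_closedBall _ _ hε.le, finrank_euclideanSpace_fin,
      Real.mul_rpow (by positivity) measureReal_nonneg, ← hc, ← Real.rpow_natCast,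
      ← Real.rpow_neg hε.le, ← Real.rpow_mul hε.le, ← mul_assoc, ← Real.rpow_add hε, mul_comm c,
      hθ]
    congr 2
    field_simp
    ring
  -- The first summand bounds the average at scale `R` by the norm of `f`. The second, from
  -- integrating `ε^(θ - 1)` over `(0, R)`, bounds its distance to `f x` by the norms of the `g i`.
  refine ⟨M * c * R ^ (θ - 1) + M * c * (R ^ θ / θ), by positivity, ?_⟩
  intro U K f g x hU hKU hRK hf hfg hfK hgK
  set Nf := (eLpNorm f (ENNReal.ofReal p) (volume.restrict K)).toReal with hNf
  set G := ∑ i, (eLpNorm (g i) (ENNReal.ofReal p) (volume.restrict K)).toReal with hG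
  have hG0 : 0 ≤ G := Finset.sum_nonneg fun _ _ => ENNReal.toReal_nonneg
  have hRU := hRK.trans hKU
  set F := scaledAverage R f x with hF
  set H : ℝ → ℝ := fun s => M * c * G * (s ^ θ / θ) with hH
  have hHd : ∀ ε, 0 < ε → HasDerivAt H (M * c * G * ε ^ (θ - 1)) ε := by
    intro ε hε
    have := ((Real.hasDerivAt_rpow_const (p := θ) (Or.inl hε.ne')).div_const θ).const_mul
      (M * c * G)
    refine this.congr_deriv ?_
    field_simp
  have hFd : ∀ ε, 0 < ε → HasDerivAt F
      (∫ y in Metric.closedBall x R, f y * scaledBumpDeriv ε (y - x)) ε := fun ε hε =>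
    hasDerivAt_scaledAverage (hf.mono hRU) hε
  have hbound : ∀ ε, 0 < ε → ε ≤ R →
      ‖∫ y in Metric.closedBall x R, f y * scaledBumpDeriv ε (y - x)‖
        ≤ M * c * G * ε ^ (θ - 1) := by
    intro ε hε hεR
    have hεK : Metric.closedBall x ε ⊆ K := (Metric.closedBall_subset_closedBall hεR).trans hRK
    rw [integral_mul_scaledBumpDeriv hU hf hfg hRU hε hεR, hG, Finset.mul_sum, Finset.sum_mul]
    refine norm_sum_le_of_le _ fun i _ => ?_
    refine (norm_setIntegral_mul_le hp1 (by positivity) (hgK i)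
      ((hfg i).2.1.integrableOn_compact_subset (hεK.trans hKU) (isCompact_closedBall x ε))
      (isCompact_closedBall x ε).measure_ne_top hεK
      fun y => abs_scaledMoment_le hM i hε (y - x)).trans_eq ?_
    linear_combination M * (eLpNorm (g i) (ENNReal.ofReal p) (volume.restrict K)).toReal *
      hvol x ε hε
  have hinc : ∀ ε ∈ Ioo 0 R, |F R - F ε| ≤ H R := by
    intro ε hε
    have hpos : ∀ s ∈ Icc ε R, 0 < s := fun s hs => hε.1.trans_le hs.1
    have h := abs_sub_le_sub_of_abs_deriv_le hε.2.le (fun s hs => hFd s (hpos s hs))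
      (fun s hs => hHd s (hpos s hs)) (fun s hs => hbound s (hpos s hs) hs.2)
    exact h.trans (sub_le_self _ (mul_nonneg (mul_nonneg (mul_nonneg hM0 hc0) hG0)
      (div_nonneg (Real.rpow_nonneg hε.1.le _) hθ0.le)))
  have hlim : |F R - f x| ≤ H R := by
    refine le_of_tendsto ((tendsto_const_nhds.sub
      (tendsto_scaledAverage hR (hf.mono hRU))).abs) ?_
    filter_upwards [Ioo_mem_nhdsGT hR] with ε hε using hinc ε hε
  have hFR : |F R| ≤ M * c * R ^ (θ - 1) * Nf := by
    refine (norm_setIntegral_mul_le hp1 (A := (R ^ n)⁻¹ * M) (by positivity) hfK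
      ((hf.mono hRU).integrableOn_compact (isCompact_closedBall x R))
      (isCompact_closedBall x R).measure_ne_top hRK fun y => ?_).trans_eq ?_
    · rw [abs_of_nonneg (scaledBump_nonneg hR _)]
      exact mul_le_mul_of_nonneg_left (hM _) (by positivity)
    · linear_combination M * Nf * hvol x R hR
  have h1 : |f x| ≤ |F R| + |F R - f x| := by
    have := abs_sub_abs_le_abs_sub (f x) (F R)
    rw [abs_sub_comm] at this
    linarith
  have hNf0 : 0 ≤ Nf := ENNReal.toReal_nonneg
  have h2 : H R = M * c * (R ^ θ / θ) * G := by simp only [hH]; ring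
  have h3 : 0 ≤ M * c * R ^ (θ - 1) * G :=
    mul_nonneg (mul_nonneg (mul_nonneg hM0 hc0) (Real.rpow_nonneg hR.le _)) hG0
  have h4 : 0 ≤ M * c * (R ^ θ / θ) * Nf :=
    mul_nonneg (mul_nonneg (mul_nonneg hM0 hc0)
      (div_nonneg (Real.rpow_nonneg hR.le _) hθ0.le)) hNf0
  rw [add_mul, mul_add, mul_add]
  linarith

end

/-! ### Vanishing noise: limit measures solve the Liouville equation -/

section

variable {n m : ℕ} {p : ℝ} {U : Set (Eucl n)}

/-- Inherited from the continuous factor `G`; the pointwise Morrey bound needs this representative.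
-/
theorem IsDiffusionMatrix.continuousOn {A : Eucl n → Matrix (Fin n) (Fin n) ℝ}
    (hA : IsDiffusionMatrix m p U A) (i j : Fin n) : ContinuousOn (fun x => A x i j) U := by
  obtain ⟨G, hG, hAG⟩ := hA.exists_noise
  have hc : ContinuousOn (fun x => (1 / 2 : ℝ) • (G x * (G x).transpose)) U := by
    refine continuousOn_iff_continuous_domRestrict.2 ?_
    have h := continuousOn_iff_continuous_domRestrict.1 hG.continuousOn
    exact (h.matrix_mul h.matrix_transpose).const_smul (1 / 2 : ℝ)
  have hA' : ContinuousOn A U := hc.congr hAG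
  exact (continuous_apply_apply i j).comp_continuousOn hA'

theorem hasWeakPartial_weakPartial {f : Eucl n → ℝ} {i : Fin n}
    (h : ∃ g, HasWeakPartial U i f g) : HasWeakPartial U i f (weakPartial U i f) := by
  rw [weakPartial, dif_pos h]
  exact h.choose_spec

/-- Convergence to zero in `W^{1,p}_loc` of continuous functions is locally uniform if `p > n`. -/
theorem eventually_forall_abs_le_of_tendsto_w1Norm (hp : (n : ℝ) < p) (hn : 0 < n)
    (hU : IsOpen U) {f : ℕ → Eucl n → ℝ} (hf : ∀ k, ContinuousOn (f k) U)
    (hfw : ∀ k i, ∃ g, HasWeakPartial U i (f k) g)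
    (hlim : ∀ K ⊆ U, IsCompact K → Tendsto (fun k => w1Norm p U K (f k)) atTop (𝓝 0))
    {K : Set (Eucl n)} (hK : IsCompact K) (hKU : K ⊆ U) {ε : ℝ} (hε : 0 < ε) :
    ∀ᶠ k in atTop, ∀ x ∈ K, |f k x| ≤ ε := by
  -- One radius `R` serves all points of `K`, so the Morrey constant is uniform and the norm is
  -- taken over one compact set.
  obtain ⟨R, hR, hRU⟩ := hK.exists_cthickening_subset_open hU hKU
  obtain ⟨C, hC, hCf⟩ := exists_abs_le_of_hasWeakPartial hn hp hR
  have h0 := hlim _ hRU hK.cthickening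
  have h1 : Tendsto (fun k => C * (w1Norm p U (Metric.cthickening R K) (f k)).toReal) atTop
      (𝓝 0) := by
    simpa using ((ENNReal.tendsto_toReal ENNReal.zero_ne_top).comp h0).const_mul C
  filter_upwards [h0.eventually (gt_mem_nhds ENNReal.zero_lt_top),
    h1.eventually (ge_mem_nhds hε)] with k hk hkε x hx
  refine le_trans ?_ hkε
  rw [w1Norm, ENNReal.add_lt_top, ENNReal.sum_lt_top] at hk
  have h := hCf U _ (f k) (fun i => weakPartial U i (f k)) x hU hRU
    (Metric.closedBall_subset_cthickening hx R) (hf k)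
    (fun i => hasWeakPartial_weakPartial (hfw k i)) hk.1.ne (fun i => (hk.2 i (Finset.mem_univ i)).ne)
  rwa [w1Norm, ENNReal.toReal_add hk.1.ne (ENNReal.sum_lt_top.2 hk.2).ne,
    ENNReal.toReal_sum fun i hi => (hk.2 i hi).ne]

theorem sum_mul_partialDeriv (f : Eucl n → ℝ) (x v : Eucl n) :
    ∑ i, v i * partialDeriv i f x = fderiv ℝ f x v := by
  have hsum : ∑ i, v i • EuclideanSpace.single i (1 : ℝ) = v := by
    simpa using (EuclideanSpace.basisFun (Fin n) ℝ).sum_repr v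
  conv_rhs => rw [← hsum, map_sum]
  simp [partialDeriv]

theorem contDiff_partialDeriv {f : Eucl n → ℝ} (hf : ContDiff ℝ ∞ f) (i : Fin n) :
    ContDiff ℝ ∞ (partialDeriv i f) :=
  (hf.fderiv_right (m := ∞) (by simp)).clm_apply contDiff_const

theorem partialDeriv_eq_zero {f : Eucl n → ℝ} {x : Eucl n} (hx : x ∉ tsupport f) (i : Fin n) :
    partialDeriv i f x = 0 := by
  rw [partialDeriv, image_eq_zero_of_notMem_tsupport fun h => hx (tsupport_fderiv_subset ℝ h)]
  rfl

theorem tsupport_partialDeriv_subset (f : Eucl n → ℝ) (i : Fin n) :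
    tsupport (partialDeriv i f) ⊆ tsupport f :=
  closure_minimal (fun _ hx => by_contra fun h => hx (partialDeriv_eq_zero h i))
    (isClosed_tsupport f)

/-- The second order part of `adjointFP`. -/
noncomputable def diffusionPart (A : Eucl n → Matrix (Fin n) (Fin n) ℝ) (f : Eucl n → ℝ)
    (x : Eucl n) : ℝ :=
  ∑ i : Fin n, ∑ j : Fin n, A x i j * partialDeriv i (partialDeriv j f) x

theorem diffusionPart_eq_zero {A : Eucl n → Matrix (Fin n) (Fin n) ℝ} {f : Eucl n → ℝ}
    {x : Eucl n} (hx : x ∉ tsupport f) : diffusionPart A f x = 0 :=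
  Finset.sum_eq_zero fun i _ => Finset.sum_eq_zero fun j _ => by
    rw [partialDeriv_eq_zero (fun h => hx (tsupport_partialDeriv_subset f j h)), mul_zero]

theorem continuousOn_diffusionPart {A : Eucl n → Matrix (Fin n) (Fin n) ℝ}
    (hA : ∀ i j, ContinuousOn (fun x => A x i j) U) {f : Eucl n → ℝ} (hf : ContDiff ℝ ∞ f) :
    ContinuousOn (diffusionPart A f) U :=
  continuousOn_finsetSum _ fun i _ => continuousOn_finsetSum _ fun j _ => (hA i j).mul
    (contDiff_partialDeriv (contDiff_partialDeriv hf j) i).continuous.continuousOn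

theorem eventually_abs_diffusionPart_le (hp : (n : ℝ) < p) (hU : IsOpen U)
    {A : ℕ → Eucl n → Matrix (Fin n) (Fin n) ℝ} (hA : ∀ k, IsDiffusionMatrix m p U (A k))
    (hlim : TendstoZeroW1 p U A atTop) {f : Eucl n → ℝ} (hf : IsTestFunction U f) {ε : ℝ}
    (hε : 0 < ε) : ∀ᶠ k in atTop, ∀ x, |diffusionPart (A k) f x| ≤ ε := by
  have hD : ∀ i j, ∃ D : ℝ, ∀ x, |partialDeriv i (partialDeriv j f) x| ≤ D := fun i j =>
    HasCompactSupport.exists_bound_of_continuous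
      (hf.2.1.of_isClosed_subset (isClosed_tsupport _) ((tsupport_partialDeriv_subset _ i).trans
        (tsupport_partialDeriv_subset f j)))
      (contDiff_partialDeriv (contDiff_partialDeriv hf.1 j) i).continuous
  choose D hD using hD
  have hD0 : ∀ i j, 0 ≤ D i j := fun i j => (abs_nonneg _).trans (hD i j 0)
  set T := ∑ i, ∑ j, D i j with hT
  have hT0 : 0 ≤ T := Finset.sum_nonneg fun i _ => Finset.sum_nonneg fun j _ => hD0 i j
  have hev : ∀ᶠ k in atTop, ∀ i j, ∀ x ∈ tsupport f, |A k x i j| ≤ ε / (T + 1) := by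
    refine eventually_all.2 fun i => eventually_all.2 fun j => ?_
    -- Morrey's inequality needs `n > 0`, which the index `i` provides; for `n = 0` there are no
    -- entries.
    exact eventually_forall_abs_le_of_tendsto_w1Norm hp (Fin.pos i) hU
      (fun k => (hA k).continuousOn i j)
      (fun k l => ((hA k).sobolev i j).2 l |>.imp fun g hg => hg.1)
      (fun K hKU hK => hlim K hKU hK i j) hf.2.1 hf.2.2 (by positivity)
  filter_upwards [hev] with k hk x
  by_cases hx : x ∈ tsupport f
  · calc |diffusionPart (A k) f x| ≤ ∑ i, ∑ j, ε / (T + 1) * D i j := by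
          refine (Finset.abs_sum_le_sum_abs _ _).trans (Finset.sum_le_sum fun i _ => ?_)
          refine (Finset.abs_sum_le_sum_abs _ _).trans (Finset.sum_le_sum fun j _ => ?_)
          rw [abs_mul]
          exact mul_le_mul (hk i j x hx) (hD i j x) (abs_nonneg _) (by positivity)
      _ = ε / (T + 1) * T := by simp only [← Finset.mul_sum, hT]
      _ ≤ ε := by
          rw [div_mul_eq_mul_div, div_le_iff₀ (by positivity)]
          nlinarith
  · rw [diffusionPart_eq_zero hx, abs_zero]
    exact hε.le

/-- By stationarity the drift integral is minus the diffusion integral; the bounds make both parts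
integrable, so the sum may be split. -/
theorem abs_integral_fderiv_le {V : Eucl n → Eucl n} (hV : ContinuousOn V U)
    {A : Eucl n → Matrix (Fin n) (Fin n) ℝ} (hA : ∀ i j, ContinuousOn (fun x => A x i j) U)
    {ν : ProbabilityMeasure U} (hν : IsStationaryMeasure V A ν) {f : Eucl n → ℝ}
    (hf : IsTestFunction U f) {B ε : ℝ} (hB : ∀ x : U, |fderiv ℝ f x (V x)| ≤ B)
    (hε : ∀ x, |diffusionPart A f x| ≤ ε) :
    |∫ x : U, fderiv ℝ f x (V x) ∂(ν : Measure U)| ≤ ε := by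
  have hg : Continuous fun x : U => fderiv ℝ f x (V x) :=
    ((hf.1.continuous_fderiv (by simp)).continuousOn.clm_apply hV).comp_continuous
      continuous_subtype_val fun x => x.2
  have hd : Continuous fun x : U => diffusionPart A f x :=
    (continuousOn_diffusionPart hA hf.1).comp_continuous continuous_subtype_val fun x => x.2
  have hgi : Integrable (fun x : U => fderiv ℝ f x (V x)) (ν : Measure U) :=
    Integrable.of_bound hg.aestronglyMeasurable B (Eventually.of_forall hB)
  have hdi : Integrable (fun x : U => diffusionPart A f x) (ν : Measure U) :=
    Integrable.of_bound hd.aestronglyMeasurable ε (Eventually.of_forall fun x => hε x)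
  have h0 := hν f hf
  have heq : ∀ x : U, adjointFP V A f x = diffusionPart A f x + fderiv ℝ f x (V x) := fun x => by
    rw [adjointFP, sum_mul_partialDeriv, diffusionPart]
  simp only [heq] at h0
  rw [integral_add hdi hgi] at h0
  rw [eq_neg_of_add_eq_zero_right h0, abs_neg, ← Real.norm_eq_abs]
  simpa using norm_integral_le_of_norm_le_const (μ := (ν : Measure U)) (C := ε)
    (f := fun x : U => diffusionPart A f x) (Eventually.of_forall fun x : U => hε x)

/-- Limit measures are weak stationary solutions of the Liouville equation. -/
theorem IsLimitMeasure.isLiouvilleStationary {ι : Type*} (hp : (n : ℝ) < p) (hU : IsOpen U)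
    {V : Eucl n → Eucl n} (hV : ContinuousOn V U) {A : ι → Eucl n → Matrix (Fin n) (Fin n) ℝ}
    (hA : ∀ α, IsDiffusionMatrix m p U (A α)) {μ : ProbabilityMeasure U}
    (hμ : IsLimitMeasure p V A μ) :
    IsLiouvilleStationary V U ((μ : Measure U).map Subtype.val) := by
  obtain ⟨α, ν, hα, hν, hlim⟩ := hμ
  have hemb : MeasurableEmbedding (Subtype.val : U → Eucl n) :=
    MeasurableEmbedding.subtype_coe hU.measurableSet
  refine ⟨?_, fun f hf => ?_⟩
  · rw [Measure.map_apply measurable_subtype_coe hU.measurableSet.compl]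
    simp
  rw [hemb.integral_map]
  have hg : Continuous fun x : U => fderiv ℝ f x (V x) :=
    ((hf.1.continuous_fderiv (by simp)).continuousOn.clm_apply hV).comp_continuous
      continuous_subtype_val fun x => x.2
  have hbound : ∃ B, ∀ x : U, |fderiv ℝ f x (V x)| ≤ B := by
    obtain ⟨B, hB0, hB⟩ := (hf.2.1.isCompact.image_of_continuousOn
      (f := fun x => fderiv ℝ f x (V x))
      (((hf.1.continuous_fderiv (by simp)).continuousOn.clm_apply hV).mono
        hf.2.2)).isBounded.exists_pos_norm_le
    refine ⟨B, fun x => ?_⟩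
    by_cases hx : (x : Eucl n) ∈ tsupport f
    · exact hB _ ⟨x, hx, rfl⟩
    · rw [image_eq_zero_of_notMem_tsupport (f := fderiv ℝ f)
        fun h => hx (tsupport_fderiv_subset ℝ h)]
      simpa using hB0.le
  obtain ⟨B, hB⟩ := hbound
  -- The function `V·∇f` is bounded and continuous on `U`, so its integrals converge to the one
  -- against `μ`; by the vanishing diffusion they also converge to `0`.
  have h1 := (ProbabilityMeasure.tendsto_iff_forall_integral_tendsto.1 hlim)
    (BoundedContinuousFunction.ofNormedAddCommGroup _ hg B hB)
  refine tendsto_nhds_unique h1 ?_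
  rw [Metric.tendsto_nhds]
  intro ε hε
  filter_upwards [eventually_abs_diffusionPart_le hp hU (fun k => hA (α k)) hα hf
    (half_pos hε)] with k hk
  rw [dist_zero_right, Real.norm_eq_abs]
  exact (abs_integral_fderiv_le hV (fun i j => (hA (α k)).continuousOn i j) (hν k) hf hB hk).trans_lt
    (half_lt_self hε)

end

/-! ### Invariance, the LaSalle principle and local concentration -/

section

variable {n : ℕ} {U : Set (Eucl n)} {V : Eucl n → Eucl n}

theorem measurableSet_of_isSigmaCompact {X : Type*} [TopologicalSpace X] [T2Space X]
    [MeasurableSpace X] [BorelSpace X] {S : Set X} (hS : IsSigmaCompact S) : MeasurableSet S := by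
  obtain ⟨K, hK, rfl⟩ := hS
  exact MeasurableSet.iUnion fun j => (hK j).measurableSet

theorem map_subtype_val_image (hU : IsOpen U) (μ : Measure U) (S : Set U) :
    μ.map Subtype.val (Subtype.val '' S) = μ S := by
  rw [(MeasurableEmbedding.subtype_coe hU.measurableSet).map_apply,
    preimage_image_eq _ Subtype.val_injective]

/-- The local flow preserves weak stationary solutions of the Liouville equation if it is global. -/
theorem isInvariantMeasure_of_isLiouvilleStationary (hU : IsOpen U) (hV : ContDiffOn ℝ 1 V U)
    (hflow : IsFlow V U) {μ : ProbabilityMeasure U}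
    (hμ : IsLiouvilleStationary V U ((μ : Measure U).map Subtype.val)) :
    IsInvariantMeasure V μ := by
  have : LocallyCompactSpace U := hU.locallyCompactSpace
  have hex : ∀ x ∈ U, ∀ t, t ∈ existenceInterval V U x := fun x hx t => by
    rw [hflow.2.1 x hx]
    exact mem_univ t
  intro B hB t
  let T : U → U := fun x => ⟨localFlow V U t x, localFlow_mem hU hV (hex x x.2 t)⟩
  have hinv : ∀ x ∈ U, ∀ s, localFlow V U (-s) (localFlow V U s x) = x := by
    intro x hx s
    obtain ⟨γ, hγ⟩ := hex x hx s
    rw [localFlow_localFlow hU hV ⟨γ, hγ⟩ right_mem_uIcc (by simp), neg_add_cancel,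
      hγ.localFlow_eq hU hV left_mem_uIcc, hγ.1]
  -- Closed subsets of `U` are σ-compact, and `T ⁻¹' C` is the image of `C` under the flow at time
  -- `-t`. This yields at once the measurability of `T` and the invariance on a generating π-system.
  have hclosed : ∀ C : Set U, IsClosed C →
      MeasurableSet (T ⁻¹' C) ∧ (μ : Measure U) (T ⁻¹' C) = (μ : Measure U) C := by
    intro C hC
    have hCσ : IsSigmaCompact (Subtype.val '' C) :=
      (isSigmaCompact_univ.of_isClosed_subset hC (subset_univ C)).image continuous_subtype_val
    have himg : localFlow V U (-t) '' (Subtype.val '' C) = Subtype.val '' (T ⁻¹' C) := by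
      ext x
      constructor
      · rintro ⟨_, ⟨y, hy, rfl⟩, rfl⟩
        have hyU := localFlow_mem hU hV (hex y y.2 (-t))
        refine ⟨⟨_, hyU⟩, ?_, rfl⟩
        have : T ⟨_, hyU⟩ = y := Subtype.ext (by simpa using hinv y y.2 (-t))
        rw [mem_preimage, this]
        exact hy
      · rintro ⟨y, hy, rfl⟩
        exact ⟨T y, ⟨T y, hy, rfl⟩, hinv y y.2 t⟩
    have h := hμ.measure_image_localFlow hU hV (t := -t) hCσ fun x hx => by
      obtain ⟨y, -, rfl⟩ := hx
      exact hex y y.2 _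
    rw [himg, map_subtype_val_image hU, map_subtype_val_image hU] at h
    exact ⟨measurableSet_of_isSigmaCompact
      (Topology.IsEmbedding.subtypeVal.isSigmaCompact_iff.2 h.1), h.2⟩
  have hT : Measurable T := measurable_of_isClosed fun C hC => (hclosed C hC).1
  have hmap : (μ : Measure U).map T = μ := by
    have := Measure.isProbabilityMeasure_map (μ := (μ : Measure U)) hT.aemeasurable
    refine ext_of_generate_finite _ (BorelSpace.measurable_eq.trans borel_eq_generateFrom_isClosed)
      isPiSystem_isClosed (fun C hC => ?_) (by simp)
    rw [Measure.map_apply hT hC.measurableSet, (hclosed C hC).2]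
  have hset : {x : U | localFlow V U t x ∈ Subtype.val '' B} = T ⁻¹' B := by
    ext x
    refine ⟨fun ⟨y, hy, hxy⟩ => ?_, fun hx => ⟨T x, hx, rfl⟩⟩
    rw [mem_preimage, ← (Subtype.ext hxy : y = T x)]
    exact hy
  rw [hset, ← Measure.map_apply hT hB, hmap]

theorem inner_gradient_right (f : Eucl n → ℝ) (x v : Eucl n) :
    inner ℝ v (∇ f x) = fderiv ℝ f x v := by
  rw [real_inner_comm, gradient, InnerProductSpace.toDual_symm_apply]

/-- A weak stationary solution of the Liouville equation with compact support is concentrated on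
the set where a monotone function has vanishing derivative along the field. -/
theorem IsLiouvilleStationary.ae_fderiv_eq_zero (hU : IsOpen U) (hV : ContinuousOn V U)
    {m : Measure (Eucl n)} [IsFiniteMeasure m] (hm : IsLiouvilleStationary V U m)
    {K : Set (Eucl n)} (hK : IsCompact K) (hKU : K ⊆ U) (hmK : m Kᶜ = 0) {f : Eucl n → ℝ}
    (hf : ContDiffOn ℝ 1 f U) (hf0 : ∀ x ∈ U, 0 ≤ fderiv ℝ f x (V x)) :
    ∀ᵐ x ∂m, fderiv ℝ f x (V x) = 0 := by
  -- The product `χ f` is an admissible test function and equals `f` near `K`, which carries `m`.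
  -- Hence the nonnegative function `V·∇f` has zero integral.
  obtain ⟨χ, hχ, hχc, hχU, hχ1, -⟩ := exists_contDiff_cutoff hK hU hKU
  have hh : ContDiff ℝ 1 fun x => χ x • f x := contDiff_smul_of_tsupport_subset hU hχ hχU hf
  have hhc : HasCompactSupport fun x => χ x • f x := hχc.smul_right
  obtain ⟨C, hC⟩ := hh.lipschitzWith_of_hasCompactSupport hhc one_ne_zero
  have hint := hm.integral_eq_zero hU hV hC hhc
    ((closure_mono (Function.support_smul_subset_left χ f)).trans hχU)
    ((hh.continuous_fderiv one_ne_zero).continuousOn.clm_apply hV) fun _ _ _ => rfl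
  have hK_ae := ae_mem_of_compl_null hmK
  have heq : ∀ x ∈ K, fderiv ℝ (fun x => χ x • f x) x (V x) = fderiv ℝ f x (V x) := by
    intro x hx
    have : (fun x => χ x • f x) =ᶠ[𝓝 x] f := by
      filter_upwards [eventually_nhdsSet_iff_forall.1 hχ1 x hx] with y hy
      rw [hy, one_smul]
    rw [this.fderiv_eq]
  rw [integral_congr_ae (hK_ae.mono heq)] at hint
  have hcont : ContinuousOn (fun x => fderiv ℝ f x (V x)) K :=
    ((hf.continuousOn_fderiv_of_isOpen hU le_rfl).clm_apply hV).mono hKU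
  have hi : Integrable (fun x => fderiv ℝ f x (V x)) m := by
    rw [← Measure.restrict_eq_self_of_ae_mem hK_ae]
    exact hcont.integrableOn_compact hK
  exact (integral_eq_zero_iff_of_nonneg_ae (hK_ae.mono fun x hx => hf0 x (hKU hx)) hi).1 hint

theorem measure_eq_one_of_isLiouvilleStationary (hU : IsOpen U) (hV : ContinuousOn V U)
    {μ : ProbabilityMeasure U}
    (hμ : IsLiouvilleStationary V U ((μ : Measure U).map Subtype.val))
    (hc : IsCompact (μ : Measure U).support) {F : Eucl n → ℝ}
    (hF : IsEntireWeakLyapunov V U F ∨ IsEntireWeakAntiLyapunov V U F) :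
    (μ : Measure U) {x : U | inner ℝ (V x) (∇ F (x : Eucl n)) = 0} = 1 := by
  have hK := hc.image continuous_subtype_val
  have hKU : Subtype.val '' (μ : Measure U).support ⊆ U := by
    rintro _ ⟨x, -, rfl⟩
    exact x.2
  have hmK : (μ : Measure U).map Subtype.val (Subtype.val '' (μ : Measure U).support)ᶜ = 0 := by
    rw [(MeasurableEmbedding.subtype_coe hU.measurableSet).map_apply, preimage_compl,
      preimage_image_eq _ Subtype.val_injective]
    exact Measure.measure_compl_support
  have hae : ∀ᵐ x ∂(μ : Measure U).map Subtype.val, fderiv ℝ F x (V x) = 0 := by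
    simp only [IsEntireWeakLyapunov, IsEntireWeakAntiLyapunov, inner_gradient_right] at hF
    rcases hF with ⟨hF1, -, hF0⟩ | ⟨hF1, -, hF0⟩
    · have := hμ.ae_fderiv_eq_zero hU hV hK hKU hmK hF1.neg fun x hx => by
        rw [fderiv_fun_neg]
        simpa using hF0 x hx
      simpa [fderiv_fun_neg] using this
    · exact hμ.ae_fderiv_eq_zero hU hV hK hKU hmK hF1 hF0
  have hae' : ∀ᵐ x : U ∂(μ : Measure U), inner ℝ (V x) (∇ F (x : Eucl n)) = 0 := by
    simpa only [inner_gradient_right] using ae_of_ae_map measurable_subtype_coe.aemeasurable hae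
  exact (measure_congr (eventuallyEq_univ.2 hae')).trans measure_univ

/-- If the iterates of the time `τ` map contract a set to `J`, then weak stationary
solutions of the Liouville equation do not charge the set outside `J`. -/
theorem IsLiouvilleStationary.measure_diff_eq_zero (hU : IsOpen U) (hV : ContDiffOn ℝ 1 V U)
    {m : Measure (Eucl n)} [IsFiniteMeasure m] (hm : IsLiouvilleStationary V U m)
    {W N J : Set (Eucl n)} (hJ : IsClosed J) (hN : IsSigmaCompact N) (hNW : N ⊆ W) {τ : ℝ}
    (hex : ∀ x ∈ W, ∀ k : ℕ, k * τ ∈ existenceInterval V U x)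
    (hW : ∀ x ∈ W, ∀ k : ℕ, localFlow V U (k * τ) x ∈ W)
    (hatt : ∀ ε : ℝ, 0 < ε → ∃ k : ℕ, ∀ x ∈ W, localFlow V U (k * τ) x ∈ Metric.thickening ε J) :
    m (N \ J) = 0 := by
  have hadd : ∀ x ∈ W, ∀ j k : ℕ, localFlow V U (j * τ) (localFlow V U (k * τ) x)
      = localFlow V U ((j + k : ℕ) * τ) x := by
    intro x hx j k
    have hmem : (k : ℝ) * τ ∈ uIcc 0 ((j + k : ℕ) * τ) := by
      push_cast
      rw [mem_uIcc]
      rcases le_total 0 τ with h | h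
      · left
        constructor <;> nlinarith [Nat.cast_nonneg (α := ℝ) j, Nat.cast_nonneg (α := ℝ) k]
      · right
        constructor <;> nlinarith [Nat.cast_nonneg (α := ℝ) j, Nat.cast_nonneg (α := ℝ) k]
    have heq : (j : ℝ) * τ + k * τ = (j + k : ℕ) * τ := by
      push_cast
      ring
    rw [localFlow_localFlow hU hV (hex x hx (j + k)) hmem (by rw [heq]; exact right_mem_uIcc), heq]
  -- `D` is mapped into itself by each time `j * τ` map, and its image has the same finite measure;
  -- so only a null set is lost.
  set D := ⋃ k : ℕ, localFlow V U (k * τ) '' N with hD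
  have hDW : D ⊆ W := by
    refine iUnion_subset fun k => ?_
    rintro _ ⟨x, hx, rfl⟩
    exact hW x (hNW hx) k
  have hDσ : IsSigmaCompact D := isSigmaCompact_iUnion _ fun k =>
    (hm.measure_image_localFlow hU hV hN fun x hx => hex x (hNW hx) k).1
  have hDD : ∀ j : ℕ, localFlow V U (j * τ) '' D ⊆ D := by
    rintro j _ ⟨y, hy, rfl⟩
    obtain ⟨k, x, hx, rfl⟩ := mem_iUnion.1 hy
    exact mem_iUnion.2 ⟨j + k, x, hx, (hadd x (hNW hx) j k).symm⟩
  have hnull : ∀ j : ℕ, m (D \ localFlow V U (j * τ) '' D) = 0 := by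
    intro j
    have h := hm.measure_image_localFlow hU hV hDσ fun x hx => hex x (hDW hx) j
    rw [measure_sdiff (hDD j) (measurableSet_of_isSigmaCompact h.1).nullMeasurableSet
      (measure_ne_top _ _), h.2, tsub_self]
  have hND : N ⊆ D := by
    intro x hx
    obtain ⟨γ, hγ⟩ := hex x (hNW hx) 0
    refine mem_iUnion.2 ⟨0, x, hx, ?_⟩
    have h0 : ((0 : ℕ) : ℝ) * τ = 0 := by simp
    rw [h0] at hγ ⊢
    rw [hγ.localFlow_eq hU hV left_mem_uIcc, hγ.1]
  refine measure_mono_null (fun x hx => ?_) (measure_iUnion_null hnull)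
  -- A point outside the closed set `J` lies outside some `ε`-neighbourhood of `J`, hence outside
  -- the image of `D` at a suitable time, and so in one of the null sets.
  have hxJ : x ∉ ⋂ (ε : ℝ) (_ : 0 < ε), Metric.thickening ε J := by
    rw [← Metric.closure_eq_iInter_thickening, hJ.closure_eq]
    exact hx.2
  simp only [mem_iInter, not_forall] at hxJ
  obtain ⟨ε, hε, hxε⟩ := hxJ
  obtain ⟨k, hk⟩ := hatt ε hε
  refine mem_iUnion.2 ⟨k, hND hx.1, ?_⟩
  rintro ⟨y, hy, rfl⟩
  exact hxε (hk y (hDW hy))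

/-- Attractor and repeller are treated together by the time step `τ = 1` or `τ = -1`. The isolating
neighbourhood is shrunk to a compact `N`, whose images under the flow are measurable; `N` does not
depend on `μ`. -/
theorem exists_nhdsSet_forall_measure_diff_eq_zero (hU : IsOpen U) (hV : ContDiffOn ℝ 1 V U)
    {J : Set (Eucl n)} (hJ : IsStrongLocalAttractor V U J ∨ IsStrongLocalRepeller V U J) :
    ∃ N : Set (Eucl n), N ⊆ U ∧ N ∈ 𝓝ˢ J ∧ ∀ μ : ProbabilityMeasure U,
      IsLiouvilleStationary V U ((μ : Measure U).map Subtype.val) →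
      (μ : Measure U) {x : U | (x : Eucl n) ∈ N \ J} = 0 := by
  obtain ⟨hJc, W, hWJ, hWU, τ, hex, hW, hatt⟩ : IsCompact J ∧ ∃ W ∈ 𝓝ˢ J, W ⊆ U ∧ ∃ τ : ℝ,
      (∀ x ∈ W, ∀ k : ℕ, k * τ ∈ existenceInterval V U x) ∧
      (∀ x ∈ W, ∀ k : ℕ, localFlow V U (k * τ) x ∈ W) ∧
      ∀ ε : ℝ, 0 < ε →
        ∃ k : ℕ, ∀ x ∈ W, localFlow V U (k * τ) x ∈ Metric.thickening ε J := by
    rcases hJ with ⟨hJc, -, W, hWJ, -, hWinv, -, hatt, -⟩ | ⟨hJc, -, W, hWJ, -, hWinv, -, hatt, -⟩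
    · refine ⟨hJc, W, hWJ, hWinv.1, 1, fun x hx k => hWinv.2.1 x hx (by simp), fun x hx k =>
        hWinv.2.2 _ (by simp) (mem_image_of_mem _ hx), fun ε hε => ?_⟩
      obtain ⟨k, hk⟩ := (tendsto_natCast_atTop_atTop.eventually (hatt ε hε)).exists
      exact ⟨k, fun x hx => by simpa using hk (mem_image_of_mem _ hx)⟩
    · refine ⟨hJc, W, hWJ, hWinv.1, -1, fun x hx k => hWinv.2.1 x hx (by simp), fun x hx k =>
        hWinv.2.2 _ (by simp) (mem_image_of_mem _ hx), fun ε hε => ?_⟩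
      obtain ⟨k, hk⟩ := ((tendsto_neg_atTop_atBot.comp
        tendsto_natCast_atTop_atTop).eventually (hatt ε hε)).exists
      exact ⟨k, fun x hx => by simpa using hk (mem_image_of_mem _ hx)⟩
  obtain ⟨N, hN, hJN, hNW⟩ := exists_compact_between hJc isOpen_interior
    (subset_interior_iff_mem_nhdsSet.2 hWJ)
  refine ⟨N, (hNW.trans interior_subset).trans hWU, subset_interior_iff_mem_nhdsSet.1 hJN,
    fun μ hμ => ?_⟩
  have h := hμ.measure_diff_eq_zero hU hV hJc.isClosed hN.isSigmaCompact
    (hNW.trans interior_subset) hex hW hatt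
  rwa [(MeasurableEmbedding.subtype_coe hU.measurableSet).map_apply] at h

end

end StationaryLimit


theorem theoremA {n m : ℕ} (hnm : n ≤ m) {p : ℝ} (hp : (n : ℝ) < p)
    (U : Set (Eucl n)) (hUo : IsOpen U) (hUc : IsConnected U)
    (V : Eucl n → Eucl n) (hV : ContinuousOn V U)
    {ι : Type*} [Preorder ι] [IsDirectedOrder ι] [Nonempty ι]
    (A : ι → Eucl n → Matrix (Fin n) (Fin n) ℝ) (hA : IsNullFamily m p U A) :
    -- invariance of limit measures
    (ContDiffOn ℝ 1 V U → IsFlow V U →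
      ∀ μ : ProbabilityMeasure U, IsLimitMeasure p V A μ → IsInvariantMeasure V μ) ∧
    -- stochastic LaSalle invariance principle
    (∀ U₀ : Eucl n → ℝ, (IsEntireWeakLyapunov V U U₀ ∨ IsEntireWeakAntiLyapunov V U U₀) →
      ∀ μ : ProbabilityMeasure U, IsLimitMeasure p V A μ →
        IsCompact (μ : Measure U).support →
        (μ : Measure U) {x : U | inner ℝ (V x) (∇ U₀ (x : Eucl n)) = 0} = 1) ∧
    -- local concentration of limit measures
    (ContDiffOn ℝ 1 V U →
      ∀ E₀ : Set (Eucl n), (IsStrongLocalAttractor V U E₀ ∨ IsStrongLocalRepeller V U E₀) →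
        ∃ W₀ : Set (Eucl n), W₀ ⊆ U ∧ W₀ ∈ 𝓝ˢ E₀ ∧
          ∀ μ : ProbabilityMeasure U, IsLimitMeasure p V A μ →
            (μ : Measure U) {x : U | (x : Eucl n) ∈ W₀ \ E₀} = 0) := by
  have hlim : ∀ μ : ProbabilityMeasure U, IsLimitMeasure p V A μ →
      IsLiouvilleStationary V U ((μ : Measure U).map Subtype.val) := fun μ hμ =>
    hμ.isLiouvilleStationary hp hUo hV hA.isDiffusion
  refine ⟨fun hV1 hflow μ hμ =>
    isInvariantMeasure_of_isLiouvilleStationary hUo hV1 hflow (hlim μ hμ),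
    fun U₀ hU₀ μ hμ hc => measure_eq_one_of_isLiouvilleStationary hUo hV (hlim μ hμ) hc hU₀,
    fun hV1 E₀ hE₀ => ?_⟩
  obtain ⟨W₀, hWU, hWE, hW⟩ := exists_nhdsSet_forall_measure_diff_eq_zero hUo hV1 hE₀
  exact ⟨W₀, hWU, hWE, fun μ hμ => hW μ (hlim μ hμ)⟩
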